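/- Let $\Omega\subset\mathbb R^n$ be a bounded Lipschitz domain (a bounded open set, not necessarily connected, that locally near its boundary is the region above the graph of a Lipschitz function), and let $\Gamma_D,\Gamma_N$ be disjoint relatively open subsets of $\partial\Omega$ with $\partial\Omega=\overline{\Gamma_D}\cup\overline{\Gamma_N}$. Let $A\in L^\infty(\Omega)^{n\times n}$ be symmetric and positive definite almost everywhere with $A^{-1}\in L^\infty(\Omega)^{n\times n}$, and write $\langle\sigma,\tau\rangle_A=\int_\Omega\sigma\cdot A\tau\,dx$ and $\|\sigma\|_A=\langle\sigma,\sigma\rangle_A^{1/2}$ for $\sigma,\tau\in\mathbf L^2(\Omega)$. Let $H^1(\Omega,\Gamma_D)$ be the space of $v\in H^1(\Omega)$ with vanishing trace along $\Gamma_D$, with the norm $(\|v\|_{L^2}^2+\|\nabla v\|_{\mathbf L^2}^2)^{1/2}$, and let $H^{-1}(\Omega,\Gamma_N)$ be its dual with the operator norm. Let $\mathscr H$ be the $L^2$-orthogonal projection onto the space $\mathscr H(\Omega,\Gamma_D)$ of locally constant functions in $H^1(\Omega,\Gamma_D)$, extended to $F\in H^{-1}(\Omega,\Gamma_N)$ by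 $(\mathscr HF)(v)=F(\mathscr Hv)$. For $\tau\in\mathbf L^2(\Omega)$ let $-\operatorname{div}A\tau\in H^{-1}(\Omega,\Gamma_N)$ be the functional $v\mapsto\langle\tau,\nabla v\rangle_A$, and let $\mathbf X=\{\tau\in\mathbf L^2(\Omega):\operatorname{div}A\tau=0\}$. Call $C>0$ a Poincaré–Friedrichs constant if (a) $\|v-\mathscr Hv\|_{L^2}\le C\|\nabla v\|_A$ for all $v\in H^1(\Omega,\Gamma_D)$, and (b) for every $F\in H^{-1}(\Omega,\Gamma_N)$ there is $\tau\in\mathbf L^2(\Omega)$ with $-\operatorname{div}A\tau=F-\mathscr HF$ and $\|\tau\|_A\le C\|F-\mathscr HF\|_{H^{-1}}$. Then a Poincaré–Friedrichs constant exists. Moreover, let $C^{PF}$ be any such constant, let $F,F_h\in H^{-1}(\Omega,\Gamma_N)$, let $u\in H^1(\Omega,\Gamma_D)$ solve $$-\operatorname{div}A\nabla u=F-\mathscr HF,\qquad u\perp_{L^2}\mathscr H(\Omega,\Gamma_D),$$ let $u_h\in H^1(\Omega,\Gamma_D)$ be arbitrary, and let $\sigma_h\in\mathbf L^2(\Omega)$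 solve the approximate flux equation $-\operatorname{div}A\sigma_h=F_h-\mathscr HF_h$. Then: 1. (Reliability) $\|\nabla u-\nabla u_h\|_A\le C^{PF}\|F-F_h\|_{H^{-1}}+\|\sigma_h-\nabla u_h\|_A$. 2. There is a unique $\widehat u\in H^1(\Omega,\Gamma_D)$ with $-\operatorname{div}A\nabla\widehat u=F_h-\mathscr HF_h$ and $\widehat u\perp_{L^2}\mathscr H(\Omega,\Gamma_D)$. The field $\widehat\theta_h:=\sigma_h-\nabla\widehat u$ belongs to $\mathbf X$ and is the unique element of $\mathbf X$ whose difference from $\sigma_h$ lies in $\nabla H^1(\Omega,\Gamma_D)$. 3. (Efficiency) If $e:=\|\nabla u-\nabla u_h\|_A\neq0$, then $$1\le C^{PF}\frac{\|F-F_h\|_{H^{-1}}}{e}+\frac{\|\sigma_h-\nabla u_h\|_A}{e}\le1+2C^{PF}\frac{\|F-F_h\|_{H^{-1}}}{e}+\frac{\|\widehat\theta_h\|_A}{e}.$$ 4. (Prager–Synge hypercircle identity) If $F_h=F$, then $\widehat u=u$ and $\|\nabla u_h-\sigma_h\|_A^2=\|\nabla u_h-\nabla u\|_A^2+\|\nabla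 u-\sigma_h\|_A^2$; if also $\|\nabla u_h-\nabla u\|_A\neq0$, then $\|\nabla u_h-\sigma_h\|_A^2/\|\nabla u_h-\nabla u\|_A^2=1+\|\widehat\theta_h\|_A^2/\|\nabla u_h-\nabla u\|_A^2$. -/

import Mathlib

open MeasureTheory Filter Topology
open scoped NNReal ENNReal Matrix ContDiff

noncomputable section

namespace PoissonFlux

/-- The Euclidean space `ℝⁿ`. -/
abbrev E (n : ℕ) : Type := EuclideanSpace ℝ (Fin n)

variable {n : ℕ}

/-! ### Domains, boundary parts, coefficients -/

/-- A bounded Lipschitz domain: a bounded open set, not necessarily connected, which near each of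
its boundary points is, for some unit vector `ν`, the set of points strictly above the graph (in
direction `ν`) of a Lipschitz function of the component orthogonal to `ν`. -/
structure IsBoundedLipschitzDomain (Ω : Set (E n)) : Prop where
  isOpen : IsOpen Ω
  isBounded : Bornology.IsBounded Ω
  lipschitz_boundary : ∀ x ∈ frontier Ω, ∃ U ∈ 𝓝 x, ∃ ν : E n, ‖ν‖ = 1 ∧
    ∃ (K : ℝ≥0) (γ : E n → ℝ), LipschitzWith K γ ∧
      ∀ y ∈ U, (y ∈ Ω ↔ γ (y - inner ℝ ν y • ν) < inner ℝ ν y)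

/-- `ΓD` and `ΓN` are disjoint relatively open parts of `∂Ω` whose closures cover `∂Ω`. -/
structure IsBoundaryPartition (Ω ΓD ΓN : Set (E n)) : Prop where
  relOpen_D : ∃ U : Set (E n), IsOpen U ∧ ΓD = U ∩ frontier Ω
  relOpen_N : ∃ U : Set (E n), IsOpen U ∧ ΓN = U ∩ frontier Ω
  cover : frontier Ω = closure ΓD ∪ closure ΓN
  disjoint : Disjoint ΓD ΓN

/-- An admissible metric tensor on `Ω`: a field of symmetric positive definite (in particular
invertible) matrices with `A, A⁻¹ ∈ L^∞(Ω)^{n × n}`. -/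
structure IsAdmissibleMetric (Ω : Set (E n)) (A : E n → Matrix (Fin n) (Fin n) ℝ) : Prop where
  bounded : ∀ i j, MemLp (fun x => A x i j) ∞ (volume.restrict Ω)
  bounded_inv : ∀ i j, MemLp (fun x => (A x)⁻¹ i j) ∞ (volume.restrict Ω)
  posDef : ∀ᵐ x ∂(volume.restrict Ω), (A x).PosDef

/-! ### Lebesgue spaces -/

/-- `L²(Ω)`. -/
abbrev L2 (Ω : Set (E n)) : Type := Lp ℝ 2 (volume.restrict Ω)

/-- The vector fields `𝐋²(Ω) = L²(Ω)ⁿ`. -/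
abbrev VL2 (Ω : Set (E n)) : Type := Lp (E n) 2 (volume.restrict Ω)

/-- `L²(Γ)` with respect to the surface measure on a part `Γ` of the boundary. -/
abbrev BL2 (Γ : Set (E n)) : Type := Lp ℝ 2 ((μH[(n : ℝ) - 1] : Measure (E n)).restrict Γ)

/-- Pairs `(v, g)` in `L²(Ω) × 𝐋²(Ω)` with the norm `(‖v‖² + ‖g‖²)^{1/2}`. -/
abbrev Pairs (Ω : Set (E n)) : Type := WithLp 2 (L2 Ω × VL2 Ω)

/-- The product `⟨σ, τ⟩_A = ∫_Ω σ · A τ dx`. -/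
def innerA {Ω : Set (E n)} (A : E n → Matrix (Fin n) (Fin n) ℝ) (σ τ : VL2 Ω) : ℝ :=
  ∫ x in Ω, (σ x).ofLp ⬝ᵥ (A x *ᵥ (τ x).ofLp)

/-- The norm `‖σ‖_A`. -/
def normA {Ω : Set (E n)} (A : E n → Matrix (Fin n) (Fin n) ℝ) (σ : VL2 Ω) : ℝ :=
  Real.sqrt (innerA A σ σ)

/-! ### Sobolev spaces

An element of `H¹(Ω)` is stored as the pair of the function and its weak gradient. -/

/-- `g` is the weak gradient of `v` on `Ω`. -/
def IsWeakGradient {Ω : Set (E n)} (v : L2 Ω) (g : VL2 Ω) : Prop :=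
  ∀ φ : E n → ℝ, ContDiff ℝ ∞ φ → HasCompactSupport φ → tsupport φ ⊆ Ω → ∀ i : Fin n,
    ∫ x in Ω, v x * gradient φ x i = - ∫ x in Ω, g x i * φ x

theorem contDiff_gradient_apply {φ : E n → ℝ} (hφ : ContDiff ℝ ∞ φ) (i : Fin n) :
    Continuous (fun x => gradient φ x i) := by
  have h1 : Continuous (fun x => gradient φ x) := by
    unfold gradient
    exact (InnerProductSpace.toDual ℝ (E n)).symm.continuous.comp
      (hφ.continuous_fderiv (by simp))
  fun_prop

/-- The defect in the definition of the weak gradient is a bounded functional of `(v, g)`. -/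
theorem exists_weakGradient_defect (Ω : Set (E n)) {φ : E n → ℝ} (hφ : ContDiff ℝ ∞ φ)
    (hc : HasCompactSupport φ) (i : Fin n) :
    ∃ L : Pairs Ω →L[ℝ] ℝ, ∀ p : Pairs Ω,
      L p = (∫ x in Ω, p.fst x * gradient φ x i) + ∫ x in Ω, p.snd x i * φ x := by
  have hg : Continuous (fun x => gradient φ x i) := contDiff_gradient_apply hφ i
  have hgc : HasCompactSupport (fun x => gradient φ x i) := by
    refine (hc.fderiv (𝕜 := ℝ)).mono' ?_
    intro x hx
    apply subset_tsupport
    intro h0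
    apply hx
    simp [gradient, h0]
  have m1 : MemLp (fun x => gradient φ x i) 2 (volume.restrict Ω) :=
    (hg.memLp_of_hasCompactSupport hgc).restrict Ω
  have hφ2 : Continuous (fun x => φ x • (EuclideanSpace.single i (1 : ℝ) : E n)) :=
    hφ.continuous.smul continuous_const
  have m2 : MemLp (fun x => φ x • (EuclideanSpace.single i (1 : ℝ) : E n)) 2
      (volume.restrict Ω) :=
    (hφ2.memLp_of_hasCompactSupport (hc.smul_right)).restrict Ω
  refine ⟨(innerSL ℝ m1.toLp).comp (WithLp.fstL 2 ℝ (L2 Ω) (VL2 Ω)) +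
    (innerSL ℝ m2.toLp).comp (WithLp.sndL 2 ℝ (L2 Ω) (VL2 Ω)), fun p => ?_⟩
  have e1 : inner ℝ m1.toLp p.fst = ∫ x in Ω, p.fst x * gradient φ x i := by
    rw [L2.inner_def]
    refine integral_congr_ae ?_
    filter_upwards [m1.coeFn_toLp] with x hx
    rw [hx]; simp
  have e2 : inner ℝ m2.toLp p.snd = ∫ x in Ω, p.snd x i * φ x := by
    rw [L2.inner_def]
    refine integral_congr_ae ?_
    filter_upwards [m2.coeFn_toLp] with x hx
    rw [hx]
    simp [inner_smul_left, EuclideanSpace.inner_single_left, mul_comm]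
  simp [e1, e2]

/-- `H¹(Ω)`, with its canonical norm. -/
def H1 (Ω : Set (E n)) : Submodule ℝ (Pairs Ω) where
  carrier := {p | IsWeakGradient p.fst p.snd}
  add_mem' := by
    intro p q hp hq φ h1 h2 h3 i
    obtain ⟨L, hL⟩ := exists_weakGradient_defect Ω h1 h2 i
    have a := hp φ h1 h2 h3 i
    have b := hq φ h1 h2 h3 i
    have c := L.map_add p q
    rw [hL, hL, hL] at c
    linarith
  zero_mem' := by
    intro φ h1 h2 h3 i
    obtain ⟨L, hL⟩ := exists_weakGradient_defect Ω h1 h2 i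
    have c := L.map_zero
    rw [hL] at c
    linarith
  smul_mem' := by
    intro r p hp φ h1 h2 h3 i
    obtain ⟨L, hL⟩ := exists_weakGradient_defect Ω h1 h2 i
    have a := hp φ h1 h2 h3 i
    have c := L.map_smul r p
    have d : L p = 0 := by rw [hL]; linarith
    rw [hL, d] at c
    simp only [smul_zero] at c
    linarith

theorem isClosed_H1 (Ω : Set (E n)) : IsClosed (H1 Ω : Set (Pairs Ω)) := by
  refine isClosed_of_closure_subset ?_
  intro p hp φ h1 h2 h3 i
  obtain ⟨L, hL⟩ := exists_weakGradient_defect Ω h1 h2 i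
  have hcl : IsClosed {q : Pairs Ω | L q = 0} := isClosed_eq L.continuous continuous_const
  have hsub : (H1 Ω : Set (Pairs Ω)) ⊆ {q | L q = 0} := by
    intro q hq
    have a := hq φ h1 h2 h3 i
    simp only [Set.mem_ofPred_eq, hL]
    linarith
  have h0 : L p = 0 := closure_minimal hsub hcl hp
  rw [hL] at h0
  linarith

/-- All triples `(φ|_Ω, ∇φ|_Ω, φ|_Γ)` of square-integrable restrictions of smooth functions
`φ : ℝⁿ → ℝ`. -/
def smoothTraceGraph (Ω Γ : Set (E n)) : Submodule ℝ (Pairs Ω × BL2 Γ) where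
  carrier := {q | ∃ φ : E n → ℝ, ContDiff ℝ ∞ φ ∧
    q.1.fst =ᵐ[volume.restrict Ω] φ ∧
    q.1.snd =ᵐ[volume.restrict Ω] gradient φ ∧
    q.2 =ᵐ[(μH[(n : ℝ) - 1] : Measure (E n)).restrict Γ] φ}
  add_mem' := by
    rintro p q ⟨φ, hφ, a1, a2, a3⟩ ⟨ψ, hψ, b1, b2, b3⟩
    refine ⟨φ + ψ, hφ.add hψ, ?_, ?_, ?_⟩
    · filter_upwards [Lp.coeFn_add p.1.fst q.1.fst, a1, b1] with x h h1 h2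
      exact h.trans (by simp [h1, h2])
    · filter_upwards [Lp.coeFn_add p.1.snd q.1.snd, a2, b2] with x h h1 h2
      have e : fderiv ℝ (φ + ψ) x = fderiv ℝ φ x + fderiv ℝ ψ x :=
        fderiv_add (hφ.differentiable (by simp) x) (hψ.differentiable (by simp) x)
      exact h.trans (by simp [h1, h2, gradient, e])
    · filter_upwards [Lp.coeFn_add p.2 q.2, a3, b3] with x h h1 h2
      exact h.trans (by simp [h1, h2])
  zero_mem' := by
    refine ⟨0, contDiff_const, Lp.coeFn_zero _ _ _, ?_, Lp.coeFn_zero _ _ _⟩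
    filter_upwards [Lp.coeFn_zero (E n) 2 (volume.restrict Ω)] with x h
    have e : fderiv ℝ (0 : E n → ℝ) x = 0 := by simp
    exact h.trans (by simp [gradient, e])
  smul_mem' := by
    rintro r p ⟨φ, hφ, a1, a2, a3⟩
    refine ⟨r • φ, contDiff_const.smul hφ, ?_, ?_, ?_⟩
    · filter_upwards [Lp.coeFn_smul r p.1.fst, a1] with x h h1
      exact h.trans (by simp [h1])
    · filter_upwards [Lp.coeFn_smul r p.1.snd, a2] with x h h1
      have e : fderiv ℝ (r • φ) x = r • fderiv ℝ φ x :=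
        fderiv_const_smul (hφ.differentiable (by simp) x) r
      exact h.trans (by simp [h1, gradient, e])
    · filter_upwards [Lp.coeFn_smul r p.2, a3] with x h h1
      exact h.trans (by simp [h1])

/-- The trace of `v ∈ H¹(Ω)` along `Γ ⊆ ∂Ω` is `g ∈ L²(Γ)`: the pair `(v, g)` is a limit, in
`H¹(Ω) × L²(Γ)`, of pairs `(φ|_Ω, φ|_Γ)` with `φ` smooth on `ℝⁿ`. That is, the trace operator is
the continuous extension of the restriction of smooth functions. -/
def HasTrace {Ω : Set (E n)} (Γ : Set (E n)) (v : Pairs Ω) (g : BL2 Γ) : Prop :=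
  (v, g) ∈ (smoothTraceGraph Ω Γ).topologicalClosure

/-- `H¹(Ω, ΓD)`: the members of `H¹(Ω)` with vanishing trace along `ΓD`. -/
def H1D (Ω ΓD : Set (E n)) : Submodule ℝ (Pairs Ω) where
  carrier := {v | v ∈ H1 Ω ∧ HasTrace ΓD v 0}
  add_mem' := by
    rintro p q ⟨hp, tp⟩ ⟨hq, tq⟩
    refine ⟨add_mem hp hq, ?_⟩
    have h := add_mem tp tq
    simpa [HasTrace] using h
  zero_mem' := ⟨zero_mem _, zero_mem (smoothTraceGraph Ω ΓD).topologicalClosure⟩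
  smul_mem' := by
    rintro r p ⟨hp, tp⟩
    refine ⟨Submodule.smul_mem _ r hp, ?_⟩
    have h := Submodule.smul_mem _ r tp
    simpa [HasTrace] using h

theorem isClosed_H1D (Ω ΓD : Set (E n)) : IsClosed (H1D Ω ΓD : Set (Pairs Ω)) := by
  have h : IsClosed {v : Pairs Ω | (v, (0 : BL2 ΓD)) ∈
      ((smoothTraceGraph Ω ΓD).topologicalClosure : Set (Pairs Ω × BL2 ΓD))} :=
    (Submodule.isClosed_topologicalClosure _).preimage (by fun_prop)
  exact (isClosed_H1 Ω).inter h

/-- The function in `L²(Ω)` underlying a member of `H¹(Ω, ΓD)`. -/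
def fn {Ω ΓD : Set (E n)} (v : H1D Ω ΓD) : L2 Ω := (v : Pairs Ω).fst

/-- The gradient of a member of `H¹(Ω, ΓD)`. -/
def grad {Ω ΓD : Set (E n)} (v : H1D Ω ΓD) : VL2 Ω := (v : Pairs Ω).snd

/-- `H⁻¹(Ω, ΓN)`: the dual space of `H¹(Ω, ΓD)` with the operator norm. -/
abbrev HNeg1 (Ω ΓD : Set (E n)) : Type := StrongDual ℝ (H1D Ω ΓD)

/-! ### Locally constant functions -/

/-- `v` agrees almost everywhere on `Ω` with a function that is constant on every connected
component of `Ω`; for open `Ω` these are the locally constant functions. -/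
def IsLocConst {Ω : Set (E n)} (v : L2 Ω) : Prop :=
  ∃ c : E n → ℝ, (∀ x ∈ Ω, ∀ y ∈ connectedComponentIn Ω x, c y = c x) ∧
    v =ᵐ[volume.restrict Ω] c

/-- `ℋ(Ω, ΓD)`: the locally constant functions (these have gradient `0`) contained in
`H¹(Ω, ΓD)`, as a subspace of `L²(Ω)`. -/
def locConst (Ω ΓD : Set (E n)) : Submodule ℝ (L2 Ω) where
  carrier := {v | IsLocConst v ∧ WithLp.toLp 2 (v, (0 : VL2 Ω)) ∈ H1D Ω ΓD}
  add_mem' := by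
    rintro v w ⟨⟨c, hc, ec⟩, hv⟩ ⟨⟨d, hd, ed⟩, hw⟩
    refine ⟨⟨c + d, fun x hx y hy => by simp [hc x hx y hy, hd x hx y hy],
      (Lp.coeFn_add v w).trans (ec.add ed)⟩, ?_⟩
    have h := add_mem hv hw
    rw [← WithLp.toLp_add] at h
    simpa using h
  zero_mem' := ⟨⟨0, fun _ _ _ _ => rfl, Lp.coeFn_zero _ _ _⟩, zero_mem (H1D Ω ΓD)⟩
  smul_mem' := by
    rintro r v ⟨⟨c, hc, ec⟩, hv⟩
    refine ⟨⟨r • c, fun x hx y hy => by simp [hc x hx y hy],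
      (Lp.coeFn_smul r v).trans (ec.const_smul r)⟩, ?_⟩
    have h := Submodule.smul_mem _ r hv
    rw [← WithLp.toLp_smul] at h
    simpa using h

theorem isClosed_isLocConst (Ω : Set (E n)) : IsClosed {v : L2 Ω | IsLocConst v} := by
  refine IsSeqClosed.isClosed ?_
  intro v w hv hw
  choose c hc ec using hv
  obtain ⟨ns, -, hns⟩ := (tendstoInMeasure_of_tendsto_Lp hw).exists_seq_tendsto_ae
  refine ⟨fun x => limUnder atTop (fun k => c (ns k) x), ?_, ?_⟩
  · intro x hx y hy
    have : (fun k => c (ns k) y) = fun k => c (ns k) x :=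
      funext fun k => hc (ns k) x hx y hy
    simp only [this]
  · have hall : ∀ᵐ x ∂(volume.restrict Ω), ∀ k, v (ns k) x = c (ns k) x :=
      ae_all_iff.2 fun k => ec (ns k)
    filter_upwards [hns, hall] with x h1 h2
    simp only [h2] at h1
    exact h1.limUnder_eq.symm

theorem isClosed_locConst (Ω ΓD : Set (E n)) : IsClosed (locConst Ω ΓD : Set (L2 Ω)) := by
  have h : Continuous (fun v : L2 Ω => (WithLp.toLp 2 (v, (0 : VL2 Ω)) : Pairs Ω)) :=
    (WithLp.prod_continuous_toLp 2 (L2 Ω) (VL2 Ω)).comp (by fun_prop)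
  exact (isClosed_isLocConst Ω).inter ((isClosed_H1D Ω ΓD).preimage h)

instance locConst_complete (Ω ΓD : Set (E n)) : CompleteSpace (locConst Ω ΓD) :=
  (isClosed_locConst Ω ΓD).completeSpace_coe

/-- The `L²`-orthogonal projection `ℋ_{Ω,ΓD}` onto `ℋ(Ω, ΓD)`, as an operator on
`H¹(Ω, ΓD)`. -/
def locProj (Ω ΓD : Set (E n)) : H1D Ω ΓD →L[ℝ] H1D Ω ΓD :=
  (((WithLp.prodContinuousLinearEquiv 2 ℝ (L2 Ω) (VL2 Ω)).symm.toContinuousLinearMap.comp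
    (((locConst Ω ΓD).starProjection.comp (WithLp.fstL 2 ℝ (L2 Ω) (VL2 Ω))).prod 0)).comp
      (H1D Ω ΓD).subtypeL).codRestrict (H1D Ω ΓD) (fun v =>
        (Submodule.starProjection_apply_mem (locConst Ω ΓD) (v : Pairs Ω).fst).2)

theorem fn_locProj {Ω ΓD : Set (E n)} (v : H1D Ω ΓD) :
    fn (locProj Ω ΓD v) = (locConst Ω ΓD).starProjection (fn v) := rfl

theorem grad_locProj {Ω ΓD : Set (E n)} (v : H1D Ω ΓD) : grad (locProj Ω ΓD v) = 0 := rfl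

/-- The extension of `ℋ_{Ω,ΓD}` to functionals, `(ℋ F)(v) = F (ℋ v)`. -/
def locProjDual {Ω ΓD : Set (E n)} (F : HNeg1 Ω ΓD) : HNeg1 Ω ΓD := F.comp (locProj Ω ΓD)

/-! ### The equations -/

/-- The flux equation `-div_{Ω,ΓN} A σ = F - ℋ F` in `H⁻¹(Ω, ΓN)`, where
`-div_{Ω,ΓN} A σ` is the functional `v ↦ ⟨σ, ∇v⟩_A`. -/
def SolvesFlux {Ω ΓD : Set (E n)} (A : E n → Matrix (Fin n) (Fin n) ℝ) (F : HNeg1 Ω ΓD)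
    (σ : VL2 Ω) : Prop :=
  ∀ v : H1D Ω ΓD, innerA A σ (grad v) = (F - locProjDual F) v

/-- The Poisson problem `-div_{Ω,ΓN} A ∇u = F - ℋ F`, `u ⊥ ℋ(Ω, ΓD)` in `L²(Ω)`. -/
def SolvesPoisson {Ω ΓD : Set (E n)} (A : E n → Matrix (Fin n) (Fin n) ℝ) (F : HNeg1 Ω ΓD)
    (u : H1D Ω ΓD) : Prop :=
  SolvesFlux A F (grad u) ∧ ∀ h ∈ locConst Ω ΓD, inner ℝ (fn u) h = 0

/-- `𝐗(Ω, ΓN, A)`: the fields `τ` with `div_{Ω,ΓN} A τ = 0`, that is, the `A`-orthogonal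
complement of the gradients of `H¹(Ω, ΓD)`. -/
def divFree (Ω ΓD : Set (E n)) (A : E n → Matrix (Fin n) (Fin n) ℝ) : Set (VL2 Ω) :=
  {τ | ∀ v : H1D Ω ΓD, innerA A τ (grad v) = 0}

/-- `C` is a Poincaré–Friedrichs constant for `Ω`, `ΓD`, `A`: both Poincaré–Friedrichs
inequalities, for the gradient and for the distributional divergence, hold with `C`. -/
structure IsPFConstant (Ω ΓD : Set (E n)) (A : E n → Matrix (Fin n) (Fin n) ℝ) (C : ℝ) :
    Prop where
  pos : 0 < C
  grad_ineq : ∀ v : H1D Ω ΓD, ‖fn (v - locProj Ω ΓD v)‖ ≤ C * normA A (grad v)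
  div_ineq : ∀ F : HNeg1 Ω ΓD, ∃ τ : VL2 Ω, SolvesFlux A F τ ∧
    normA A τ ≤ C * ‖F - locProjDual F‖

end PoissonFlux

end

open PoissonFlux

/-!
The theorem rests on the Poincaré–Friedrichs inequality `‖v - ℋv‖ ≤ C ‖∇v‖` on `H¹(Ω, ΓD)`
(`exists_norm_sub_locProj_le`); the rest is Hilbert space geometry.

Members of `H¹(Ω, ΓD)` are limits of smooth functions, because the trace is defined by such limits.
For a smooth `φ` and sets `Q`, `B` such that all segments from `Q` to `B` run inside `Ω`, the double
integral of `|φ x - φ y|²` over `Q × B` is bounded by the Dirichlet energy of `φ` on `Ω`, by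
integrating along segments and using only translations of `∇φ`
(`lintegral_lintegral_enorm_sub_sq_le`). Hence a function deviates on `Q` from its mean over `B` by
at most a multiple of its gradient (`exists_norm_restrict_sub_const_le`). In a Lipschitz domain,
every point of the closure has a neighbourhood `V` such that `Q = V ∩ Ω` admits such a ball `B`,
placed far enough above the boundary graph (`exists_nhds_segment_subset`). By compactness of the
closure, the gradient and finitely many means together control the `L²` norm
(`exists_norm_fst_le`). With `Q = B` a ball, the same estimate shows that functions with vanishing
gradient are locally constant (`isLocConst_of_snd_eq_zero`). A compactness argument that involves
only the finitely many means (`exists_norm_le_of_ker`) then removes these means on the kernel of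
`ℋ`; no compact embedding of `H¹(Ω)` is needed.

The weighted product `⟨σ, τ⟩_A` is an equivalent inner product on `𝐋²(Ω)`. The Lax–Milgram lemma
solves the Poisson problem (`exists_solvesPoisson`), and the gradient of its solution is the field
demanded by the second Poincaré–Friedrichs inequality. Both error estimates follow from the
decomposition `σh - ∇uh = θ + ∇(û - u) + ∇(u - uh)`, in which `θ` is `A`-orthogonal to gradients
and `‖∇(û - u)‖_A ≤ C ‖F - Fh‖` (`normA_grad_sub_le`). For `F = Fh` the middle term vanishes and the
decomposition is the hypercircle identity.
-/

namespace PoissonFlux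

/-! ### The translation estimate -/

theorem eLpNorm_two_sq {α F : Type*} [MeasurableSpace α] [NormedAddCommGroup F] (μ : Measure α)
    (f : α → F) : eLpNorm f 2 μ ^ 2 = ∫⁻ x, ‖f x‖ₑ ^ 2 ∂μ := by
  rw [eLpNorm_eq_lintegral_rpow_enorm_toReal (by simp) (by simp), ← ENNReal.rpow_natCast,
    ← ENNReal.rpow_mul]
  simp

theorem enorm_integral_sq_le {α : Type*} [MeasurableSpace α] (μ : Measure α)
    [IsProbabilityMeasure μ] {f : α → ℝ} (hf : AEStronglyMeasurable f μ) :
    ‖∫ x, f x ∂μ‖ₑ ^ 2 ≤ ∫⁻ x, ‖f x‖ₑ ^ 2 ∂μ := by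
  rw [← eLpNorm_two_sq]
  gcongr
  calc ‖∫ x, f x ∂μ‖ₑ ≤ ∫⁻ x, ‖f x‖ₑ ∂μ := enorm_integral_le_lintegral_enorm f
    _ = eLpNorm f 1 μ := eLpNorm_one_eq_lintegral_enorm.symm
    _ ≤ eLpNorm f 2 μ := eLpNorm_le_eLpNorm_of_exponent_le (by norm_num) hf

theorem continuous_gradient {n : ℕ} {φ : E n → ℝ} (hφ : ContDiff ℝ ∞ φ) :
    Continuous (gradient φ) :=
  (InnerProductSpace.toDual ℝ (E n)).symm.continuous.comp (hφ.continuous_fderiv (by simp))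

/-- The fundamental theorem of calculus along the segment from `x` to `x + z`, followed by Jensen's
inequality. -/
theorem enorm_sub_sq_le_lintegral_gradient {n : ℕ} {φ : E n → ℝ} (hφ : ContDiff ℝ ∞ φ)
    (x z : E n) :
    ‖φ x - φ (x + z)‖ₑ ^ 2 ≤
      ‖z‖ₑ ^ 2 * ∫⁻ s in Set.Ioc (0 : ℝ) 1, ‖gradient φ (x + s • z)‖ₑ ^ 2 := by
  have hg := continuous_gradient hφ
  have hder : ∀ s : ℝ, HasDerivAt (fun s : ℝ => φ (x + s • z))
      (inner ℝ (gradient φ (x + s • z)) z) s := by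
    intro s
    have h1 : HasFDerivAt φ (fderiv ℝ φ (x + s • z)) (x + s • z) :=
      (hφ.differentiable (by simp) _).hasFDerivAt
    have h2 : HasDerivAt (fun s : ℝ => x + s • z) z s := by
      simpa using ((hasDerivAt_id s).smul_const z).const_add x
    have h3 := h1.comp_hasDerivAt s h2
    have e : inner ℝ (gradient φ (x + s • z)) z = fderiv ℝ φ (x + s • z) z := by
      simp [gradient, InnerProductSpace.toDual_symm_apply]
    rw [e]
    exact h3
  have hc : Continuous (fun s : ℝ => inner ℝ (gradient φ (x + s • z)) z) := by fun_prop
  have hftc := intervalIntegral.integral_eq_sub_of_hasDerivAt (a := 0) (b := 1)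
    (fun s _ => hder s) (hc.intervalIntegrable _ _)
  simp only [one_smul, zero_smul, add_zero] at hftc
  have : IsProbabilityMeasure (volume.restrict (Set.Ioc (0 : ℝ) 1)) := ⟨by simp⟩
  rw [intervalIntegral.integral_of_le zero_le_one] at hftc
  have e : ‖φ x - φ (x + z)‖ₑ = ‖∫ s in Set.Ioc (0 : ℝ) 1,
      inner ℝ (gradient φ (x + s • z)) z‖ₑ := by
    rw [hftc, ← enorm_neg, neg_sub]
  rw [e]
  refine (enorm_integral_sq_le _ hc.aestronglyMeasurable).trans ?_
  rw [← lintegral_const_mul' _ _ (by simp)]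
  refine lintegral_mono fun s => ?_
  rw [← mul_pow]
  gcongr
  rw [mul_comm]
  simp only [← ofReal_norm]
  rw [← ENNReal.ofReal_mul (norm_nonneg _)]
  exact ENNReal.ofReal_le_ofReal (norm_inner_le_norm _ _)

/-- If all segments from `Q` to `B` run inside `Ω`, the oscillation of a smooth function between
`Q` and `B` is controlled by its Dirichlet energy on `Ω`. Substituting `y = x + z` reduces the
estimate to translations of the gradient by `s • z`, so that no Jacobian enters. -/
theorem lintegral_lintegral_enorm_sub_sq_le {n : ℕ} {Ω Q B : Set (E n)} (hΩ : MeasurableSet Ω)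
    (hQ : MeasurableSet Q) (hB : MeasurableSet B) {R : ℝ}
    (hR : ∀ x ∈ Q, ∀ y ∈ B, ‖y - x‖ ≤ R) (hseg : ∀ x ∈ Q, ∀ y ∈ B, segment ℝ x y ⊆ Ω)
    {φ : E n → ℝ} (hφ : ContDiff ℝ ∞ φ) :
    ∫⁻ x in Q, ∫⁻ y in B, ‖φ x - φ y‖ₑ ^ 2 ≤
      volume (Metric.closedBall (0 : E n) R) * ENNReal.ofReal R ^ 2 *
        ∫⁻ x in Ω, ‖gradient φ x‖ₑ ^ 2 := by
  have hg := continuous_gradient hφ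
  set G : E n → ℝ≥0∞ := Ω.indicator (fun x => ‖gradient φ x‖ₑ ^ 2) with hG
  have hGm : Measurable G := by
    refine Measurable.indicator ?_ hΩ
    have := hg.measurable
    fun_prop
  have hGi : ∫⁻ x, G x = ∫⁻ x in Ω, ‖gradient φ x‖ₑ ^ 2 := lintegral_indicator hΩ _
  have key : ∀ x z : E n, Q.indicator (fun x => B.indicator
      (fun y => ‖φ x - φ y‖ₑ ^ 2) (x + z)) x ≤
      (Metric.closedBall (0 : E n) R).indicator (fun _ => ENNReal.ofReal R ^ 2) z *
        ∫⁻ s in Set.Ioc (0 : ℝ) 1, G (x + s • z) := by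
    intro x z
    by_cases hx : x ∈ Q
    swap
    · rw [Set.indicator_of_notMem hx]
      exact zero_le
    rw [Set.indicator_of_mem hx]
    by_cases hy : x + z ∈ B
    swap
    · rw [Set.indicator_of_notMem hy]
      exact zero_le
    have hz : ‖z‖ ≤ R := by simpa using hR x hx _ hy
    have hzb : z ∈ Metric.closedBall (0 : E n) R := by simpa using hz
    rw [Set.indicator_of_mem hy, Set.indicator_of_mem hzb]
    refine (enorm_sub_sq_le_lintegral_gradient hφ x z).trans ?_
    refine mul_le_mul' (pow_le_pow_left' ?_ 2) ?_
    · rw [← ofReal_norm]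
      exact ENNReal.ofReal_le_ofReal hz
    · refine setLIntegral_mono' measurableSet_Ioc fun s hs => ?_
      have hmem : x + s • z ∈ Ω := by
        refine hseg x hx _ hy ?_
        rw [segment_eq_image']
        exact ⟨s, ⟨hs.1.le, hs.2⟩, by simp⟩
      rw [hG, Set.indicator_of_mem hmem]
  have hφc : Continuous φ := hφ.continuous
  calc ∫⁻ x in Q, ∫⁻ y in B, ‖φ x - φ y‖ₑ ^ 2
      = ∫⁻ x, ∫⁻ z, Q.indicator (fun x => B.indicator
          (fun y => ‖φ x - φ y‖ₑ ^ 2) (x + z)) x := by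
        rw [← lintegral_indicator hQ]
        refine lintegral_congr fun x => ?_
        by_cases hx : x ∈ Q
        · simp only [Set.indicator_of_mem hx]
          rw [← lintegral_indicator hB]
          exact (lintegral_add_left_eq_self (μ := (volume : Measure (E n))) _ x).symm
        · simp [hx]
    _ ≤ ∫⁻ x, ∫⁻ z, (Metric.closedBall (0 : E n) R).indicator
          (fun _ => ENNReal.ofReal R ^ 2) z * ∫⁻ s in Set.Ioc (0 : ℝ) 1, G (x + s • z) :=
        lintegral_mono fun x => lintegral_mono fun z => key x z
    _ = ∫⁻ z, ∫⁻ x, (Metric.closedBall (0 : E n) R).indicator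
          (fun _ => ENNReal.ofReal R ^ 2) z * ∫⁻ s in Set.Ioc (0 : ℝ) 1, G (x + s • z) := by
        refine lintegral_lintegral_swap (Measurable.aemeasurable ?_)
        refine Measurable.mul ?_ ?_
        · exact (measurable_const.indicator Metric.isClosed_closedBall.measurableSet).comp
            measurable_snd
        · refine Measurable.lintegral_prod_right'
            (f := fun q : (E n × E n) × ℝ => G (q.1.1 + q.2 • q.1.2)) ?_
          exact hGm.comp (by fun_prop)
    _ = ∫⁻ z, (Metric.closedBall (0 : E n) R).indicator
          (fun _ => ENNReal.ofReal R ^ 2) z * ∫⁻ x, G x := by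
        refine lintegral_congr fun z => ?_
        rw [lintegral_const_mul]
        swap
        · refine Measurable.lintegral_prod_right'
            (f := fun q : E n × ℝ => G (q.1 + q.2 • z)) ?_
          exact hGm.comp (by fun_prop)
        congr 1
        rw [lintegral_lintegral_swap]
        swap
        · exact (hGm.comp (by fun_prop : Measurable fun q : E n × ℝ => q.1 + q.2 • z)).aemeasurable
        simp [lintegral_add_right_eq_self]
    _ = _ := by
        rw [lintegral_mul_const _
          (measurable_const.indicator Metric.isClosed_closedBall.measurableSet),
          lintegral_indicator Metric.isClosed_closedBall.measurableSet, hGi]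
        simp [mul_comm]

theorem lintegral_enorm_sub_average_sq_le {n : ℕ} {Q B : Set (E n)} (h0 : volume B ≠ 0)
    (h1 : volume B ≠ ⊤) {φ : E n → ℝ} (hφ : Continuous φ) (hint : IntegrableOn φ B) :
    ∫⁻ x in Q, ‖φ x - (volume B).toReal⁻¹ * ∫ y in B, φ y‖ₑ ^ 2 ≤
      (volume B)⁻¹ * ∫⁻ x in Q, ∫⁻ y in B, ‖φ x - φ y‖ₑ ^ 2 := by
  -- the mean over `B` is the integral against the probability measure `ν`
  set ν : Measure (E n) := (volume B)⁻¹ • volume.restrict B with hν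
  have : IsProbabilityMeasure ν := ⟨by simp [hν, ENNReal.inv_mul_cancel h0 h1]⟩
  have hi : Integrable φ ν := hint.smul_measure (by simp [h0])
  have hm : (volume B).toReal⁻¹ * ∫ y in B, φ y = ∫ y, φ y ∂ν := by
    rw [hν, integral_smul_measure, ENNReal.toReal_inv, smul_eq_mul]
  rw [hm, ← lintegral_const_mul' _ _ (by simp [h0])]
  refine lintegral_mono fun x => ?_
  have e : φ x - ∫ y, φ y ∂ν = ∫ y, (φ x - φ y) ∂ν := by
    rw [integral_sub (integrable_const _) hi]; simp
  rw [e]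
  refine (enorm_integral_sq_le ν
    (f := fun y => φ x - φ y) (by fun_prop)).trans ?_
  rw [hν, lintegral_smul_measure, smul_eq_mul]

/-! ### Local Poincaré inequalities for limits of smooth functions -/

/-- The restrictions to `Ω` of the pairs `(φ, ∇φ)` of square-integrable smooth functions on the
whole space. -/
def smoothPairs {n : ℕ} (Ω : Set (E n)) : Set (Pairs Ω) :=
  {p | ∃ φ : E n → ℝ, ContDiff ℝ ∞ φ ∧ p.fst =ᵐ[volume.restrict Ω] φ ∧
    p.snd =ᵐ[volume.restrict Ω] gradient φ}

/-- Members of `H¹(Ω, ΓD)` are limits of smooth functions: the trace is defined by such limits. -/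
theorem mem_closure_smoothPairs {n : ℕ} {Ω ΓD : Set (E n)} (v : H1D Ω ΓD) :
    (v : Pairs Ω) ∈ closure (smoothPairs Ω) := by
  have h : ((v : Pairs Ω), (0 : BL2 ΓD)) ∈
      closure (smoothTraceGraph Ω ΓD : Set (Pairs Ω × BL2 ΓD)) := v.2.2
  refine map_mem_closure (f := Prod.fst) continuous_fst h ?_
  rintro p ⟨φ, h1, h2, h3, -⟩
  exact ⟨φ, h1, h2, h3⟩

/-- If all segments from `Q` to `B` run inside `Ω`, a function deviates on `Q` from its mean `m`
over `B` by at most a multiple of its gradient on `Ω`. -/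
theorem exists_norm_restrict_sub_const_le {n : ℕ} {Ω Q B : Set (E n)} (hΩ : IsOpen Ω)
    (hΩb : Bornology.IsBounded Ω) [IsFiniteMeasure ((volume.restrict Ω).restrict Q)]
    (hQ : MeasurableSet Q) (hQΩ : Q ⊆ Ω) (hB : IsOpen B) (hBn : B.Nonempty) (hBΩ : B ⊆ Ω)
    (hseg : ∀ x ∈ Q, ∀ y ∈ B, segment ℝ x y ⊆ Ω) :
    ∃ (m : L2 Ω →L[ℝ] ℝ) (c : ℝ), 0 ≤ c ∧ ∀ p ∈ closure (smoothPairs Ω),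
      ‖LpToLpRestrictCLM (E n) ℝ ℝ (volume.restrict Ω) 2 Q p.fst -
        Lp.constL 2 ((volume.restrict Ω).restrict Q) ℝ (m p.fst)‖ ≤ c * ‖p.snd‖ := by
  obtain ⟨R, hR⟩ := (Metric.isBounded_iff.1 hΩb)
  have hBb := hΩb.subset hBΩ
  have h0 : volume B ≠ 0 := (hB.measure_pos volume hBn).ne'
  have h1 : volume B ≠ ⊤ := hBb.measure_lt_top.ne
  have hBr : (volume.restrict Ω) B ≠ ⊤ :=
    ((Measure.restrict_apply_le _ _).trans_lt hBb.measure_lt_top).ne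
  have hrB : (volume.restrict Ω).restrict B = volume.restrict B := by
    rw [Measure.restrict_restrict hB.measurableSet, Set.inter_eq_left.2 hBΩ]
  have hrQ : (volume.restrict Ω).restrict Q = volume.restrict Q := by
    rw [Measure.restrict_restrict hQ, Set.inter_eq_left.2 hQΩ]
  set m : L2 Ω →L[ℝ] ℝ := (volume B).toReal⁻¹ •
    innerSL ℝ (indicatorConstLp 2 hB.measurableSet hBr (1 : ℝ)) with hm
  have hmv : ∀ v, m v = (volume B).toReal⁻¹ * ∫ y in B, v y := by
    intro v
    rw [hm]
    simp only [smul_apply, innerSL_apply_apply, smul_eq_mul]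
    rw [L2.inner_indicatorConstLp_one, hrB]
  set K : ℝ≥0∞ := (volume B)⁻¹ * (volume (Metric.closedBall (0 : E n) R) *
    ENNReal.ofReal R ^ 2) with hK
  have hKt : K ≠ ⊤ := by
    refine ENNReal.mul_ne_top (by simp [h0]) (ENNReal.mul_ne_top ?_ (by simp))
    exact Metric.isBounded_closedBall.measure_lt_top.ne
  refine ⟨m, Real.sqrt K.toReal, Real.sqrt_nonneg _, fun p hp => ?_⟩
  -- both sides are continuous in `p`, so that smooth pairs suffice
  refine closure_minimal (t := {p : Pairs Ω |
    ‖LpToLpRestrictCLM (E n) ℝ ℝ (volume.restrict Ω) 2 Q p.fst -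
        Lp.constL 2 ((volume.restrict Ω).restrict Q) ℝ (m p.fst)‖ ≤
      Real.sqrt K.toReal * ‖p.snd‖}) ?_ ?_ hp
  swap
  · have c1 : Continuous fun p : Pairs Ω => p.fst := (WithLp.fstL 2 ℝ (L2 Ω) (VL2 Ω)).continuous
    have c2 : Continuous fun p : Pairs Ω => p.snd := (WithLp.sndL 2 ℝ (L2 Ω) (VL2 Ω)).continuous
    refine isClosed_le ?_ ?_
    · fun_prop
    · fun_prop
  rintro p ⟨φ, hφ, e1, e2⟩
  have hφc := hφ.continuous
  have hint : IntegrableOn φ B :=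
    (hφc.continuousOn.integrableOn_compact hBb.isCompact_closure).mono_set subset_closure
  set q := LpToLpRestrictCLM (E n) ℝ ℝ (volume.restrict Ω) 2 Q p.fst -
        Lp.constL 2 ((volume.restrict Ω).restrict Q) ℝ (m p.fst) with hq
  have hmp : m p.fst = (volume B).toReal⁻¹ * ∫ y in B, φ y := by
    rw [hmv]
    congr 1
    rw [← hrB]
    exact integral_congr_ae (ae_restrict_of_ae e1)
  have hqe : q =ᵐ[(volume.restrict Ω).restrict Q]
      fun x => φ x - (volume B).toReal⁻¹ * ∫ y in B, φ y := by
    filter_upwards [Lp.coeFn_sub (LpToLpRestrictCLM (E n) ℝ ℝ (volume.restrict Ω) 2 Q p.fst)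
        (Lp.constL 2 ((volume.restrict Ω).restrict Q) ℝ (m p.fst)),
      LpToLpRestrictCLM_coeFn ℝ Q p.fst, ae_restrict_of_ae e1,
      Lp.coeFn_const 2 ((volume.restrict Ω).restrict Q) (m p.fst)] with x a b c d
    rw [hq, a, Pi.sub_apply, b, c, ← hmp]
    congr 1
  have hmain : ‖q‖ₑ ^ 2 ≤ K * ‖p.snd‖ₑ ^ 2 := by
    rw [Lp.enorm_def, Lp.enorm_def, eLpNorm_congr_ae hqe, eLpNorm_congr_ae e2, eLpNorm_two_sq,
      eLpNorm_two_sq, hrQ]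
    refine (lintegral_enorm_sub_average_sq_le h0 h1 hφc hint).trans ?_
    rw [hK, mul_assoc]
    gcongr
    refine lintegral_lintegral_enorm_sub_sq_le hΩ.measurableSet hQ hB.measurableSet ?_ hseg hφ
    intro x hx y hy
    rw [← dist_eq_norm]
    exact hR (hBΩ hy) (hQΩ hx)
  have hreal : ‖q‖ ^ 2 ≤ K.toReal * ‖p.snd‖ ^ 2 := by
    have := ENNReal.toReal_mono (ENNReal.mul_ne_top hKt (by simp)) hmain
    simpa using this
  show ‖q‖ ≤ _
  refine le_of_sq_le_sq ?_ (by positivity)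
  rw [mul_pow, Real.sq_sqrt ENNReal.toReal_nonneg]
  exact hreal

/-! ### Geometry of Lipschitz domains -/

theorem norm_sub_inner_smul_le {n : ℕ} {ν : E n} (hν : ‖ν‖ = 1) (w : E n) :
    ‖w - inner ℝ ν w • ν‖ ≤ ‖w‖ := by
  refine le_of_sq_le_sq ?_ (norm_nonneg _)
  rw [norm_sub_sq_real, inner_smul_right, norm_smul, hν, real_inner_comm w ν, Real.norm_eq_abs,
    mul_one, sq_abs]
  nlinarith [sq_nonneg (inner ℝ ν w)]

/-- Near every point of its closure, a Lipschitz domain is seen along segments from a common ball: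
at a boundary point, the ball lies so far above the graph, compared to its radius, that segments
towards it rise more steeply than the graph. -/
theorem exists_nhds_segment_subset {n : ℕ} {Ω : Set (E n)} (hΩ : IsBoundedLipschitzDomain Ω)
    {x₀ : E n} (hx₀ : x₀ ∈ closure Ω) :
    ∃ V B : Set (E n), IsOpen V ∧ x₀ ∈ V ∧ IsOpen B ∧ B.Nonempty ∧ B ⊆ Ω ∧
      ∀ x ∈ V ∩ Ω, ∀ y ∈ B, segment ℝ x y ⊆ Ω := by
  by_cases hx : x₀ ∈ Ω
  · obtain ⟨r, hr, hrΩ⟩ := Metric.isOpen_iff.1 hΩ.isOpen x₀ hx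
    refine ⟨Metric.ball x₀ r, Metric.ball x₀ r, Metric.isOpen_ball, Metric.mem_ball_self hr,
      Metric.isOpen_ball, ⟨x₀, Metric.mem_ball_self hr⟩, hrΩ, fun x hx y hy => ?_⟩
    exact ((convex_ball x₀ r).segment_subset hx.1 hy).trans hrΩ
  have hfr : x₀ ∈ frontier Ω := ⟨hx₀, by rwa [hΩ.isOpen.interior_eq]⟩
  obtain ⟨U, hU, ν, hν, K, γ, hγ, hgr⟩ := hΩ.lipschitz_boundary x₀ hfr
  obtain ⟨r, hr, hrU⟩ := Metric.mem_nhds_iff.1 hU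
  set ε : ℝ := r / (2 * K + 4) with hε
  have hK : (0 : ℝ) ≤ K := K.2
  have hε0 : 0 < ε := by positivity
  have hεr : (2 * K + 2) * ε + 2 * ε = r := by rw [hε]; field_simp; ring
  -- at this height, a vector from `ball x₀ ε` to the ball `B` has horizontal part at most `2 * ε`
  -- and rises by at least `t - 2 * ε = K * (2 * ε)`
  set t : ℝ := (2 * K + 2) * ε with ht
  have ht0 : 0 ≤ t := by positivity
  have hVr : Metric.ball x₀ ε ⊆ Metric.ball x₀ r := Metric.ball_subset_ball (by linarith)
  have hBr : Metric.ball (x₀ + t • ν) ε ⊆ Metric.ball x₀ r := by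
    refine Metric.ball_subset_ball' ?_
    rw [dist_eq_norm, add_sub_cancel_left, norm_smul, hν, Real.norm_of_nonneg ht0]
    linarith
  have hseg : ∀ x ∈ Metric.ball x₀ ε ∩ Ω, ∀ y ∈ Metric.ball (x₀ + t • ν) ε,
      segment ℝ x y ⊆ Ω := by
    intro x hx y hy p hp
    have hpU : p ∈ U := hrU ((convex_ball x₀ r).segment_subset (hVr hx.1) (hBr hy) hp)
    rw [segment_eq_image'] at hp
    obtain ⟨s, ⟨hs0, hs1⟩, rfl⟩ := hp
    have hxg := (hgr x (hrU (hVr hx.1))).1 hx.2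
    refine (hgr _ hpU).2 ?_
    set w : E n := y - x - t • ν with hw
    have hwn : ‖w‖ ≤ 2 * ε := by
      have e : w = (y - (x₀ + t • ν)) - (x - x₀) := by rw [hw]; abel
      rw [e]
      refine (norm_sub_le _ _).trans ?_
      have a := mem_ball_iff_norm.1 hy
      have b := mem_ball_iff_norm.1 hx.1
      linarith
    have hyx : y - x = w + t • ν := by rw [hw]; abel
    have hνν : inner ℝ ν ν = 1 := by rw [real_inner_self_eq_norm_sq, hν]; norm_num
    have hin : inner ℝ ν (x + s • (y - x)) = inner ℝ ν x + s * (inner ℝ ν w + t) := by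
      rw [hyx, inner_add_right, inner_smul_right, inner_add_right, inner_smul_right, hνν, mul_one]
    have hlip := hγ.dist_le_mul (x + s • (y - x) - inner ℝ ν (x + s • (y - x)) • ν)
      (x - inner ℝ ν x • ν)
    have hdiff : x + s • (y - x) - inner ℝ ν (x + s • (y - x)) • ν - (x - inner ℝ ν x • ν)
        = s • (w - inner ℝ ν w • ν) := by
      rw [hin, hyx]
      module
    rw [dist_eq_norm, dist_eq_norm, hdiff, norm_smul, Real.norm_of_nonneg hs0] at hlip
    have h1 := (le_abs_self _).trans hlip
    have h2 : ‖w - inner ℝ ν w • ν‖ ≤ 2 * ε := (norm_sub_inner_smul_le hν w).trans hwn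
    have h3 : (K : ℝ) * (s * ‖w - inner ℝ ν w • ν‖) ≤ K * (s * (2 * ε)) := by gcongr
    have h4 : -(2 * ε) ≤ inner ℝ ν w := by
      have := (abs_real_inner_le_norm ν w).trans (by rw [hν, one_mul])
      linarith [(abs_le.1 this).1]
    have h5 : s * (2 * K * ε) ≤ s * (inner ℝ ν w + t) :=
      mul_le_mul_of_nonneg_left (by rw [ht]; linarith) hs0
    have h6 : (K : ℝ) * (s * (2 * ε)) = s * (2 * K * ε) := by ring
    show γ (x + s • (y - x) - inner ℝ ν (x + s • (y - x)) • ν) < inner ℝ ν (x + s • (y - x))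
    rw [h6] at h3
    linarith [hin]
  refine ⟨Metric.ball x₀ ε, Metric.ball (x₀ + t • ν) ε, Metric.isOpen_ball,
    Metric.mem_ball_self hε0, Metric.isOpen_ball, ⟨_, Metric.mem_ball_self hε0⟩,
    fun y hy => ?_, hseg⟩
  obtain ⟨x, hxΩ, hxd⟩ := Metric.mem_closure_iff.1 hx₀ ε hε0
  rw [dist_comm] at hxd
  exact hseg x ⟨hxd, hxΩ⟩ y hy (right_mem_segment ℝ x y)

/-! ### The gradient controls functions up to finitely many means -/

/-- On a bounded Lipschitz domain, the gradient together with finitely many means controls the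
`L²` norm. -/
theorem exists_norm_fst_le {n : ℕ} {Ω : Set (E n)} (hΩ : IsBoundedLipschitzDomain Ω) :
    ∃ (t : Finset (closure Ω)) (P : L2 Ω →L[ℝ] (t → ℝ)) (c : ℝ), 0 ≤ c ∧
      ∀ p ∈ closure (smoothPairs Ω), ‖p.fst‖ ≤ c * (‖p.snd‖ + ‖P p.fst‖) := by
  have : IsFiniteMeasure (volume.restrict Ω) := ⟨by simpa using hΩ.isBounded.measure_lt_top⟩
  have key : ∀ x : closure Ω, ∃ V : Set (E n), V ∈ 𝓝 (x : E n) ∧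
      ∃ (m : L2 Ω →L[ℝ] ℝ) (c : ℝ), 0 ≤ c ∧ ∀ p ∈ closure (smoothPairs Ω),
        ‖LpToLpRestrictCLM (E n) ℝ ℝ (volume.restrict Ω) 2 (V ∩ Ω) p.fst‖ ≤
          c * (‖p.snd‖ + ‖m p.fst‖) := by
    rintro ⟨x, hx⟩
    obtain ⟨V, B, hV, hxV, hB, hBn, hBΩ, hseg⟩ := exists_nhds_segment_subset hΩ hx
    obtain ⟨m, c, hc, h⟩ := exists_norm_restrict_sub_const_le hΩ.isOpen hΩ.isBounded
      (hV.measurableSet.inter hΩ.isOpen.measurableSet) Set.inter_subset_right hB hBn hBΩ hseg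
    refine ⟨V, hV.mem_nhds hxV, m,
      c + ‖Lp.constL 2 ((volume.restrict Ω).restrict (V ∩ Ω)) ℝ (E := ℝ)‖, by positivity,
      fun p hp => ?_⟩
    have h1 := h p hp
    have h2 := (Lp.constL 2 ((volume.restrict Ω).restrict (V ∩ Ω)) ℝ (E := ℝ)).le_opNorm (m p.fst)
    have h3 := norm_le_norm_add_norm_sub'
      (LpToLpRestrictCLM (E n) ℝ ℝ (volume.restrict Ω) 2 (V ∩ Ω) p.fst)
      (Lp.constL 2 ((volume.restrict Ω).restrict (V ∩ Ω)) ℝ (m p.fst))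
    have h4 := norm_nonneg (Lp.constL 2 ((volume.restrict Ω).restrict (V ∩ Ω)) ℝ (E := ℝ))
    have h5 := norm_nonneg (m p.fst)
    have h6 := norm_nonneg p.snd
    nlinarith [mul_nonneg hc h5, mul_nonneg h4 h6]
  choose V hV m c hc h using key
  obtain ⟨t, ht⟩ := hΩ.isBounded.isCompact_closure.elim_nhds_subcover'
    (fun x hx => V ⟨x, hx⟩) (fun x hx => hV ⟨x, hx⟩)
  -- squares of norms add up over the cover, which produces this constant
  refine ⟨t, ContinuousLinearMap.pi fun x => m x, Real.sqrt (∑ x : t, c x ^ 2),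
    Real.sqrt_nonneg _, fun p hp => ?_⟩
  set P : L2 Ω →L[ℝ] (t → ℝ) := ContinuousLinearMap.pi fun x => m x with hP
  have hloc : ∀ x : t, ‖LpToLpRestrictCLM (E n) ℝ ℝ (volume.restrict Ω) 2 (V x ∩ Ω) p.fst‖ ≤
      c x * (‖p.snd‖ + ‖P p.fst‖) := by
    intro x
    refine (h x p hp).trans ?_
    have := hc x
    have h1 : ‖m x p.fst‖ ≤ ‖P p.fst‖ := norm_le_pi_norm (P p.fst) x
    gcongr
  have henorm : ‖p.fst‖ₑ ^ 2 ≤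
      ∑ x : t, ‖LpToLpRestrictCLM (E n) ℝ ℝ (volume.restrict Ω) 2 (V x ∩ Ω) p.fst‖ₑ ^ 2 := by
    simp only [Lp.enorm_def, eLpNorm_congr_ae (LpToLpRestrictCLM_coeFn ℝ _ p.fst),
      eLpNorm_two_sq]
    have hsub : Ω ⊆ ⋃ x : t, V x ∩ Ω := by
      intro y hy
      obtain ⟨x, hx, hxy⟩ := Set.mem_iUnion₂.1 (ht (subset_closure hy))
      exact Set.mem_iUnion.2 ⟨⟨x, hx⟩, hxy, hy⟩
    have e : (volume.restrict Ω).restrict (⋃ x : t, V x ∩ Ω) = volume.restrict Ω := by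
      rw [Measure.restrict_restrict' hΩ.isOpen.measurableSet, Set.inter_eq_right.2 hsub]
    calc ∫⁻ y in Ω, ‖p.fst y‖ₑ ^ 2
        = ∫⁻ y in ⋃ x : t, V x ∩ Ω, ‖p.fst y‖ₑ ^ 2 ∂(volume.restrict Ω) := by rw [e]
      _ ≤ _ := (lintegral_iUnion_le _ _).trans_eq (tsum_fintype _)
  have hreal : ‖p.fst‖ ^ 2 ≤
      ∑ x : t, ‖LpToLpRestrictCLM (E n) ℝ ℝ (volume.restrict Ω) 2 (V x ∩ Ω) p.fst‖ ^ 2 := by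
    have h1 := ENNReal.toReal_mono (by simp) henorm
    rw [ENNReal.toReal_sum (by simp)] at h1
    simpa using h1
  refine le_of_sq_le_sq (hreal.trans ?_) (by positivity)
  rw [mul_pow, Real.sq_sqrt (by positivity), Finset.sum_mul]
  refine Finset.sum_le_sum fun x _ => ?_
  rw [← mul_pow]
  exact pow_le_pow_left₀ (norm_nonneg _) (hloc x) 2

/-! ### Functions with vanishing gradient -/

/-- A function with vanishing gradient equals its mean on every ball inside `Ω`. The means over
overlapping balls agree, so that they form a locally constant representative. -/
theorem isLocConst_of_snd_eq_zero {n : ℕ} {Ω : Set (E n)} (hΩ : IsBoundedLipschitzDomain Ω)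
    {p : Pairs Ω} (hp : p ∈ closure (smoothPairs Ω)) (h0 : p.snd = 0) : IsLocConst p.fst := by
  have : IsFiniteMeasure (volume.restrict Ω) := ⟨by simpa using hΩ.isBounded.measure_lt_top⟩
  have key : ∀ x : E n, ∃ (r a : ℝ), x ∈ Ω → 0 < r ∧ Metric.ball x r ⊆ Ω ∧
      ∀ᵐ y, y ∈ Metric.ball x r → p.fst y = a := by
    intro x
    by_cases hx : x ∈ Ω
    swap
    · exact ⟨0, 0, fun h => absurd h hx⟩
    obtain ⟨r, hr, hrΩ⟩ := Metric.isOpen_iff.1 hΩ.isOpen x hx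
    obtain ⟨m, c, hc, h⟩ := exists_norm_restrict_sub_const_le hΩ.isOpen hΩ.isBounded
      Metric.isOpen_ball.measurableSet hrΩ Metric.isOpen_ball ⟨x, Metric.mem_ball_self hr⟩ hrΩ
      (fun y hy z hz => ((convex_ball x r).segment_subset hy hz).trans hrΩ)
    refine ⟨r, m p.fst, fun _ => ⟨hr, hrΩ, ?_⟩⟩
    have h1 := h p hp
    rw [h0, norm_zero, mul_zero] at h1
    have h2 := sub_eq_zero.1 (norm_le_zero_iff.1 h1)
    have h3 := LpToLpRestrictCLM_coeFn ℝ (Metric.ball x r) p.fst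
    have h4 := Lp.coeFn_const 2 ((volume.restrict Ω).restrict (Metric.ball x r)) (m p.fst)
    rw [h2] at h3
    have h5 : p.fst =ᵐ[(volume.restrict Ω).restrict (Metric.ball x r)]
        Function.const _ (m p.fst) := h3.symm.trans h4
    rw [Measure.restrict_restrict Metric.isOpen_ball.measurableSet,
      Set.inter_eq_left.2 hrΩ] at h5
    exact (ae_restrict_iff' Metric.isOpen_ball.measurableSet).1 h5
  choose r a hra using key
  have hball : ∀ x ∈ Ω, ∀ y ∈ Ω, y ∈ Metric.ball x (r x) → a x = a y := by
    intro x hx y hy hyx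
    obtain ⟨-, -, h1⟩ := hra x hx
    obtain ⟨h2, -, h3⟩ := hra y hy
    have hpos : volume (Metric.ball x (r x) ∩ Metric.ball y (r y)) ≠ 0 :=
      ((Metric.isOpen_ball.inter Metric.isOpen_ball).measure_pos volume
        ⟨y, hyx, Metric.mem_ball_self h2⟩).ne'
    by_contra hne
    refine hpos (measure_mono_null ?_ (ae_iff.1 (h1.and h3)))
    rintro z ⟨hz1, hz2⟩ ⟨e1, e2⟩
    exact hne ((e1 hz1).symm.trans (e2 hz2))
  refine ⟨a, fun x hx y hy => ?_, ?_⟩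
  · refine (isPreconnected_connectedComponentIn (F := Ω) (x := x)).induction₂
      (fun y z => a y = a z) ?_ (fun _ _ _ _ _ _ => Eq.trans) (fun _ _ _ _ => Eq.symm) hy
      (mem_connectedComponentIn hx)
    intro z hz
    have hzΩ := connectedComponentIn_subset _ _ hz
    filter_upwards [self_mem_nhdsWithin,
      mem_nhdsWithin_of_mem_nhds (Metric.ball_mem_nhds z (hra z hzΩ).1)] with w hw hwz
    exact hball z hzΩ w (connectedComponentIn_subset _ _ hw) hwz
  · rw [Filter.EventuallyEq, ae_restrict_iff' hΩ.isOpen.measurableSet, ae_iff]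
    refine measure_null_of_locally_null _ fun x hx => ?_
    have hxΩ : x ∈ Ω := by by_contra h; exact hx fun h' => absurd h' h
    obtain ⟨h1, h2, h3⟩ := hra x hxΩ
    refine ⟨_, inter_mem_nhdsWithin _ (Metric.ball_mem_nhds x h1), ?_⟩
    refine measure_mono_null ?_ (ae_iff.1 h3)
    rintro y ⟨hy1, hy2⟩ hy3
    exact hy1 fun hyΩ => (hy3 hy2).trans (hball x hxΩ y hyΩ hy2)

/-! ### The Poincaré–Friedrichs inequality -/

/-- If `G`, together with an operator `P` into a finite-dimensional space, controls the norm, and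
`G` is injective on the kernel of `π`, then `G` alone controls the norm there: along a sequence of
unit vectors with `G w → 0`, the values of `P` subconverge, hence so do the vectors. -/
theorem exists_norm_le_of_ker {X Y Z W : Type*} [NormedAddCommGroup X] [NormedSpace ℝ X]
    [CompleteSpace X] [NormedAddCommGroup Y] [NormedSpace ℝ Y] [NormedAddCommGroup Z]
    [NormedSpace ℝ Z] [NormedAddCommGroup W] [NormedSpace ℝ W] [ProperSpace W]
    (G : X →L[ℝ] Y) (P : X →L[ℝ] W) (π : X →L[ℝ] Z) {c : ℝ} (hc : 0 ≤ c)
    (h : ∀ v, ‖v‖ ≤ c * (‖G v‖ + ‖P v‖)) (hker : ∀ v, G v = 0 → π v = 0 → v = 0) :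
    ∃ C : ℝ, 0 < C ∧ ∀ v, π v = 0 → ‖v‖ ≤ C * ‖G v‖ := by
  by_contra! hcon
  choose v hv0 hv using fun k : ℕ => hcon (k + 1) (by positivity)
  have hvn : ∀ k, 0 < ‖v k‖ := fun k => lt_of_le_of_lt (by positivity) (hv k)
  set w : ℕ → X := fun k => ‖v k‖⁻¹ • v k with hw
  have hw1 : ∀ k, ‖w k‖ = 1 := fun k => by
    simp [hw, norm_smul, (hvn k).ne']
  have hwπ : ∀ k, π (w k) = 0 := fun k => by simp [hw, hv0]
  have hwG : ∀ k : ℕ, ‖G (w k)‖ ≤ 1 / ((k : ℝ) + 1) := fun k => by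
    have h1 : (0 : ℝ) < (k : ℝ) + 1 := by positivity
    simp only [hw, map_smul, norm_smul, norm_inv, norm_norm]
    rw [inv_mul_le_iff₀ (hvn k), mul_one_div, le_div_iff₀ h1, mul_comm]
    exact (hv k).le
  have hG0 : Tendsto (fun k => G (w k)) atTop (𝓝 0) :=
    squeeze_zero_norm hwG tendsto_one_div_add_atTop_nhds_zero_nat
  obtain ⟨a, -, ψ, hψ, hPa⟩ := tendsto_subseq_of_bounded
    (Metric.isBounded_closedBall (x := (0 : W)) (r := ‖P‖)) (x := fun k => P (w k))
    (fun k => by simpa [hw1] using P.le_opNorm (w k))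
  have hL : Tendsto (fun k => (G.prod P) (w (ψ k))) atTop (𝓝 (0, a)) :=
    (hG0.comp hψ.tendsto_atTop).prodMk_nhds hPa
  -- `(G, P)` is bounded below, so that convergence of the images makes `w ∘ ψ` a Cauchy sequence
  have hanti : AntilipschitzWith (2 * c).toNNReal (G.prod P) := by
    refine (G.prod P).antilipschitz_of_bound fun x => ?_
    have h1 : ‖G x‖ ≤ ‖(G.prod P) x‖ := norm_fst_le ((G.prod P) x)
    have h2 : ‖P x‖ ≤ ‖(G.prod P) x‖ := norm_snd_le ((G.prod P) x)
    rw [Real.coe_toNNReal _ (by positivity)]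
    nlinarith [h x, mul_le_mul_of_nonneg_left (add_le_add h1 h2) hc]
  have hcau : CauchySeq fun k => w (ψ k) := by
    rw [CauchySeq, ← (hanti.isUniformInducing (G.prod P).uniformContinuous).cauchy_map_iff,
      Filter.map_map]
    exact hL.cauchySeq
  obtain ⟨x, hx⟩ := cauchySeq_tendsto_of_complete hcau
  have hxG : G x = 0 := tendsto_nhds_unique ((G.continuous.tendsto x).comp hx)
    (hG0.comp hψ.tendsto_atTop)
  have hxπ : π x = 0 := by
    refine tendsto_nhds_unique ((π.continuous.tendsto x).comp hx) ?_
    simp [Function.comp_def, hwπ]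
  have hx1 : ‖x‖ = 1 := by
    refine tendsto_nhds_unique ((continuous_norm.tendsto x).comp hx) ?_
    simp [Function.comp_def, hw1]
  rw [hker x hxG hxπ, norm_zero] at hx1
  exact zero_ne_one hx1

section H1D

variable {n : ℕ} {Ω ΓD : Set (E n)}

instance H1D_complete (Ω ΓD : Set (E n)) : CompleteSpace (H1D Ω ΓD) :=
  (isClosed_H1D Ω ΓD).completeSpace_coe

/-- `v ↦ v` as a continuous linear map from `H¹(Ω, ΓD)` to `L²(Ω)`. -/
noncomputable def fnL (Ω ΓD : Set (E n)) : H1D Ω ΓD →L[ℝ] L2 Ω :=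
  (WithLp.fstL 2 ℝ (L2 Ω) (VL2 Ω)).comp (H1D Ω ΓD).subtypeL

/-- `v ↦ ∇v` as a continuous linear map from `H¹(Ω, ΓD)` to `𝐋²(Ω)`. -/
noncomputable def gradL (Ω ΓD : Set (E n)) : H1D Ω ΓD →L[ℝ] VL2 Ω :=
  (WithLp.sndL 2 ℝ (L2 Ω) (VL2 Ω)).comp (H1D Ω ΓD).subtypeL

theorem gradL_apply (v : H1D Ω ΓD) : gradL Ω ΓD v = grad v := rfl

theorem grad_sub (v w : H1D Ω ΓD) : grad (v - w) = grad v - grad w := rfl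

theorem fn_sub (v w : H1D Ω ΓD) : fn (v - w) = fn v - fn w := rfl

theorem norm_sq_eq_fn_grad (v : H1D Ω ΓD) : ‖v‖ ^ 2 = ‖fn v‖ ^ 2 + ‖grad v‖ ^ 2 :=
  WithLp.prod_norm_sq_eq_of_L2 (v : Pairs Ω)

theorem eq_zero_of_fn_grad {v : H1D Ω ΓD} (h1 : fn v = 0) (h2 : grad v = 0) : v = 0 := by
  have h := norm_sq_eq_fn_grad v
  rw [h1, h2] at h
  simpa using h

theorem norm_fn_le (v : H1D Ω ΓD) : ‖fn v‖ ≤ ‖v‖ :=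
  le_of_sq_le_sq (by rw [norm_sq_eq_fn_grad v]; nlinarith [sq_nonneg ‖grad v‖]) (norm_nonneg _)

theorem norm_le_fn_add_grad (v : H1D Ω ΓD) : ‖v‖ ≤ ‖fn v‖ + ‖grad v‖ :=
  le_of_sq_le_sq (by
    rw [norm_sq_eq_fn_grad v]
    nlinarith [mul_nonneg (norm_nonneg (fn v)) (norm_nonneg (grad v))]) (by positivity)

theorem locProj_locProj (v : H1D Ω ΓD) : locProj Ω ΓD (locProj Ω ΓD v) = locProj Ω ΓD v := by
  rw [← sub_eq_zero]
  refine eq_zero_of_fn_grad ?_ (by rw [grad_sub, grad_locProj, grad_locProj, sub_zero])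
  rw [fn_sub, fn_locProj, fn_locProj, sub_eq_zero, Submodule.starProjection_eq_self_iff]
  exact Submodule.starProjection_apply_mem _ _

theorem locProj_eq_zero_iff (v : H1D Ω ΓD) :
    locProj Ω ΓD v = 0 ↔ ∀ h ∈ locConst Ω ΓD, inner ℝ (fn v) h = 0 := by
  have e : locProj Ω ΓD v = 0 ↔ (locConst Ω ΓD).starProjection (fn v) = 0 :=
    ⟨fun h => by rw [← fn_locProj, h]; rfl,
      fun h => eq_zero_of_fn_grad (by rw [fn_locProj, h]) (grad_locProj v)⟩
  rw [e, Submodule.starProjection_apply_eq_zero_iff, Submodule.mem_orthogonal']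

theorem norm_sub_locProj_le (v : H1D Ω ΓD) : ‖v - locProj Ω ΓD v‖ ≤ ‖v‖ := by
  refine le_of_sq_le_sq ?_ (norm_nonneg _)
  rw [norm_sq_eq_fn_grad, norm_sq_eq_fn_grad v, grad_sub, grad_locProj, sub_zero, fn_sub,
    fn_locProj]
  have h := Submodule.norm_sq_eq_add_norm_sq_starProjection (fn v) (locConst Ω ΓD)
  rw [Submodule.starProjection_orthogonal_val] at h
  nlinarith [sq_nonneg ‖(locConst Ω ΓD).starProjection (fn v)‖]

theorem sub_locProjDual_apply (F : HNeg1 Ω ΓD) (v : H1D Ω ΓD) :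
    (F - locProjDual F) v = F (v - locProj Ω ΓD v) := by
  rw [map_sub]; rfl

theorem norm_sub_locProjDual_le (F : HNeg1 Ω ΓD) : ‖F - locProjDual F‖ ≤ ‖F‖ := by
  refine ContinuousLinearMap.opNorm_le_bound _ (norm_nonneg F) fun v => ?_
  rw [sub_locProjDual_apply]
  refine (F.le_opNorm _).trans ?_
  have := norm_sub_locProj_le v
  gcongr

theorem mem_locConst_of_grad_eq_zero (hΩ : IsBoundedLipschitzDomain Ω) {v : H1D Ω ΓD}
    (h : grad v = 0) : fn v ∈ locConst Ω ΓD := by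
  refine ⟨isLocConst_of_snd_eq_zero hΩ (mem_closure_smoothPairs v) h, ?_⟩
  have e : (WithLp.toLp 2 (fn v, (0 : VL2 Ω)) : Pairs Ω) = v := by
    rw [← h]; rfl
  rw [e]
  exact v.2

/-- The Poincaré–Friedrichs inequality, in the full norm of `H¹`. -/
theorem exists_norm_sub_locProj_le (hΩ : IsBoundedLipschitzDomain Ω) (ΓD : Set (E n)) :
    ∃ C : ℝ, 0 < C ∧ ∀ v : H1D Ω ΓD, ‖v - locProj Ω ΓD v‖ ≤ C * ‖grad v‖ := by
  obtain ⟨t, P, c, hc, h⟩ := exists_norm_fst_le hΩ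
  have hnorm : ∀ v : H1D Ω ΓD, ‖v‖ ≤ (c + 1) * (‖gradL Ω ΓD v‖ + ‖P.comp (fnL Ω ΓD) v‖) := by
    intro v
    refine (norm_le_fn_add_grad v).trans ?_
    have h1 : ‖fn v‖ ≤ c * (‖grad v‖ + ‖P (fn v)‖) := h _ (mem_closure_smoothPairs v)
    show _ ≤ (c + 1) * (‖grad v‖ + ‖P (fn v)‖)
    nlinarith [norm_nonneg (P (fn v))]
  have hker : ∀ v : H1D Ω ΓD, gradL Ω ΓD v = 0 → locProj Ω ΓD v = 0 → v = 0 := by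
    intro v h1 h2
    refine eq_zero_of_fn_grad ?_ h1
    have h3 := Submodule.starProjection_eq_self_iff.2 (mem_locConst_of_grad_eq_zero hΩ h1)
    rw [← h3, ← fn_locProj, h2]
    rfl
  obtain ⟨C, hC, hv⟩ := exists_norm_le_of_ker _ _ _ (by positivity) hnorm hker
  refine ⟨C, hC, fun v => ?_⟩
  have := hv (v - locProj Ω ΓD v) (by rw [map_sub, locProj_locProj, sub_self])
  rwa [gradL_apply, grad_sub, grad_locProj, sub_zero] at this

end H1D

/-! ### The weighted product -/

theorem abs_dotProduct_mulVec_le {n : ℕ} {M : ℝ} {A : Matrix (Fin n) (Fin n) ℝ}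
    (hA : ∀ i j, |A i j| ≤ M) (x y : E n) :
    |x.ofLp ⬝ᵥ (A *ᵥ y.ofLp)| ≤ n * n * M * (‖x‖ * ‖y‖) := by
  simp only [dotProduct, Matrix.mulVec, Finset.mul_sum]
  have h : ∀ i j : Fin n, |x i * (A i j * y j)| ≤ M * (‖x‖ * ‖y‖) := by
    intro i j
    rw [abs_mul, abs_mul]
    have h1 : |x i| ≤ ‖x‖ := PiLp.norm_apply_le x i
    have h2 : |y j| ≤ ‖y‖ := PiLp.norm_apply_le y j
    have h3 := hA i j
    have h4 : 0 ≤ M := (abs_nonneg _).trans h3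
    calc |x i| * (|A i j| * |y j|) ≤ ‖x‖ * (M * ‖y‖) := by gcongr
      _ = _ := by ring
  refine (Finset.abs_sum_le_sum_abs _ _).trans ?_
  refine (Finset.sum_le_sum fun i _ => (Finset.abs_sum_le_sum_abs _ _).trans
    (Finset.sum_le_sum fun j _ => h i j)).trans (le_of_eq ?_)
  simp
  ring

theorem norm_sq_eq_dotProduct {n : ℕ} (x : E n) : ‖x‖ ^ 2 = x.ofLp ⬝ᵥ x.ofLp := by
  rw [EuclideanSpace.real_norm_sq_eq]
  simp [dotProduct, sq]

/-- A bound `x · A⁻¹ x ≤ c |x|²` makes the positive definite matrix `A` coercive, as seen by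
expanding `(x - c⁻¹ A⁻¹ x) · A (x - c⁻¹ A⁻¹ x) ≥ 0`. -/
theorem norm_sq_le_of_posDef {n : ℕ} {c : ℝ} (hc : 0 < c) {A : Matrix (Fin n) (Fin n) ℝ}
    (hA : A.PosDef) (x : E n) (hx : x.ofLp ⬝ᵥ (A⁻¹ *ᵥ x.ofLp) ≤ c * ‖x‖ ^ 2) :
    ‖x‖ ^ 2 ≤ c * (x.ofLp ⬝ᵥ (A *ᵥ x.ofLp)) := by
  have hdet : IsUnit A.det := (Matrix.isUnit_iff_isUnit_det A).1 hA.isUnit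
  have hsymm : Aᵀ = A := by simpa [Matrix.IsHermitian] using hA.isHermitian
  set z := A⁻¹ *ᵥ x.ofLp with hz
  have hAz : A *ᵥ z = x.ofLp := by
    rw [hz, Matrix.mulVec_mulVec, Matrix.mul_nonsing_inv _ hdet, Matrix.one_mulVec]
  have h := hA.posSemidef.dotProduct_mulVec_nonneg (x.ofLp - c⁻¹ • z)
  have hzA : z ⬝ᵥ (A *ᵥ x.ofLp) = x.ofLp ⬝ᵥ x.ofLp := by
    rw [Matrix.dotProduct_mulVec, ← Matrix.mulVec_transpose, hsymm, hAz]
  have e : (x.ofLp - c⁻¹ • z) ⬝ᵥ (A *ᵥ (x.ofLp - c⁻¹ • z)) =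
      x.ofLp ⬝ᵥ (A *ᵥ x.ofLp) - 2 * c⁻¹ * ‖x‖ ^ 2 + c⁻¹ ^ 2 * (x.ofLp ⬝ᵥ z) := by
    rw [Matrix.mulVec_sub, Matrix.mulVec_smul, hAz, sub_dotProduct, dotProduct_sub,
      dotProduct_sub, smul_dotProduct, smul_dotProduct, dotProduct_smul, dotProduct_smul, hzA,
      norm_sq_eq_dotProduct, dotProduct_comm z]
    simp only [smul_eq_mul]
    ring
  rw [star_trivial, e] at h
  have h2 : c⁻¹ ^ 2 * (x.ofLp ⬝ᵥ z) ≤ c⁻¹ ^ 2 * (c * ‖x‖ ^ 2) := by gcongr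
  have h3 : c⁻¹ ^ 2 * (c * ‖x‖ ^ 2) = c⁻¹ * ‖x‖ ^ 2 := by field_simp
  have h4 : c⁻¹ * ‖x‖ ^ 2 ≤ x.ofLp ⬝ᵥ (A *ᵥ x.ofLp) := by linarith
  rwa [inv_mul_le_iff₀ hc] at h4

section Metric

variable {n : ℕ} {Ω : Set (E n)} {A : E n → Matrix (Fin n) (Fin n) ℝ}

/-- Finitely many essentially bounded functions have a common bound almost everywhere. -/
theorem exists_ae_abs_le_of_memLp_top {α ι : Type*} [MeasurableSpace α] [Finite ι]
    {μ : Measure α} {f : ι → α → ℝ} (hf : ∀ i, MemLp (f i) ⊤ μ) :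
    ∃ M : ℝ, 0 ≤ M ∧ ∀ᵐ x ∂μ, ∀ i, |f i x| ≤ M := by
  have := Fintype.ofFinite ι
  refine ⟨∑ i, (eLpNorm (f i) ⊤ μ).toReal, by positivity, ?_⟩
  rw [ae_all_iff]
  intro i
  have h := (hf i).2
  rw [eLpNorm_exponent_top] at h
  filter_upwards [ae_le_eLpNormEssSup (f := f i) (μ := μ)] with x hx
  have h1 := ENNReal.toReal_mono h.ne hx
  rw [toReal_enorm, Real.norm_eq_abs] at h1
  refine h1.trans ?_
  have := Finset.single_le_sum (f := fun i => (eLpNorm (f i) ⊤ μ).toReal)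
    (fun _ _ => ENNReal.toReal_nonneg) (Finset.mem_univ i)
  simpa [eLpNorm_exponent_top] using this

theorem IsAdmissibleMetric.exists_upper (hA : IsAdmissibleMetric Ω A) :
    ∃ c : ℝ, 0 ≤ c ∧ ∀ᵐ x ∂(volume.restrict Ω), ∀ s t : E n,
      |s.ofLp ⬝ᵥ (A x *ᵥ t.ofLp)| ≤ c * (‖s‖ * ‖t‖) := by
  obtain ⟨M, hM, h⟩ := exists_ae_abs_le_of_memLp_top
    (f := fun (ij : Fin n × Fin n) x => A x ij.1 ij.2) (fun ij => hA.bounded ij.1 ij.2)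
  refine ⟨n * n * M, by positivity, ?_⟩
  filter_upwards [h] with x hx s t
  exact abs_dotProduct_mulVec_le (fun i j => hx (i, j)) s t

theorem IsAdmissibleMetric.exists_lower (hA : IsAdmissibleMetric Ω A) :
    ∃ c : ℝ, 0 < c ∧ ∀ᵐ x ∂(volume.restrict Ω), ∀ t : E n,
      ‖t‖ ^ 2 ≤ c * (t.ofLp ⬝ᵥ (A x *ᵥ t.ofLp)) := by
  obtain ⟨M, hM, h⟩ := exists_ae_abs_le_of_memLp_top
    (f := fun (ij : Fin n × Fin n) x => (A x)⁻¹ ij.1 ij.2) (fun ij => hA.bounded_inv ij.1 ij.2)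
  refine ⟨n * n * M + 1, by positivity, ?_⟩
  filter_upwards [h, hA.posDef] with x hx hp t
  refine norm_sq_le_of_posDef (by positivity) hp t ?_
  have := (le_abs_self _).trans (abs_dotProduct_mulVec_le (fun i j => hx (i, j)) t t)
  nlinarith [sq_nonneg ‖t‖]

theorem IsAdmissibleMetric.integrable (hA : IsAdmissibleMetric Ω A) (σ τ : VL2 Ω) :
    Integrable (fun x => (σ x).ofLp ⬝ᵥ (A x *ᵥ (τ x).ofLp)) (volume.restrict Ω) := by
  obtain ⟨c, hc, h⟩ := hA.exists_upper
  have hcoord : ∀ (ρ : VL2 Ω) (i : Fin n),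
      AEStronglyMeasurable (fun x => (ρ x).ofLp i) (volume.restrict Ω) := fun ρ i =>
    (EuclideanSpace.proj (𝕜 := ℝ) i).continuous.comp_aestronglyMeasurable
      (Lp.aestronglyMeasurable ρ)
  have hint : Integrable (fun x => c * (‖σ x‖ * ‖τ x‖)) (volume.restrict Ω) :=
    ((Lp.memLp σ).norm.integrable_mul (Lp.memLp τ).norm).const_mul c
  refine hint.mono' ?_ ?_
  · simp only [dotProduct, Matrix.mulVec, Finset.mul_sum]
    refine Finset.aestronglyMeasurable_fun_sum _ fun i _ =>
      Finset.aestronglyMeasurable_fun_sum _ fun j _ => ?_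
    exact (hcoord σ i).mul ((hA.bounded i j).1.mul (hcoord τ j))
  · filter_upwards [h] with x hx
    exact hx _ _

theorem innerA_add_left (hA : IsAdmissibleMetric Ω A) (σ σ' τ : VL2 Ω) :
    innerA A (σ + σ') τ = innerA A σ τ + innerA A σ' τ := by
  rw [innerA, innerA, innerA, ← integral_add (hA.integrable _ _) (hA.integrable _ _)]
  refine integral_congr_ae ?_
  filter_upwards [Lp.coeFn_add σ σ'] with x hx
  rw [hx, Pi.add_apply, WithLp.ofLp_add, add_dotProduct]

theorem innerA_smul_left (r : ℝ) (σ τ : VL2 Ω) :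
    innerA A (r • σ) τ = r * innerA A σ τ := by
  rw [innerA, innerA, ← integral_const_mul]
  refine integral_congr_ae ?_
  filter_upwards [Lp.coeFn_smul r σ] with x hx
  rw [hx, Pi.smul_apply, WithLp.ofLp_smul, smul_dotProduct, smul_eq_mul]

theorem innerA_comm (hA : IsAdmissibleMetric Ω A) (σ τ : VL2 Ω) :
    innerA A σ τ = innerA A τ σ := by
  refine integral_congr_ae ?_
  filter_upwards [hA.posDef] with x hx
  have hsymm : (A x)ᵀ = A x := by simpa [Matrix.IsHermitian] using hx.isHermitian
  rw [Matrix.dotProduct_mulVec, ← Matrix.mulVec_transpose, hsymm, dotProduct_comm]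

theorem innerA_nonneg (hA : IsAdmissibleMetric Ω A) (σ : VL2 Ω) : 0 ≤ innerA A σ σ := by
  refine integral_nonneg_of_ae ?_
  filter_upwards [hA.posDef] with x hx
  simpa using hx.posSemidef.dotProduct_mulVec_nonneg (σ x).ofLp

/-- `⟨σ, τ⟩_A` as a bilinear form. -/
noncomputable def innerAForm (hA : IsAdmissibleMetric Ω A) : LinearMap.BilinForm ℝ (VL2 Ω) :=
  LinearMap.mk₂ ℝ (innerA A) (innerA_add_left hA) innerA_smul_left
    (fun σ τ τ' => by
      rw [innerA_comm hA, innerA_add_left hA, innerA_comm hA τ, innerA_comm hA τ'])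
    (fun r σ τ => by rw [innerA_comm hA, innerA_smul_left, innerA_comm hA τ, smul_eq_mul])

theorem innerAForm_apply (hA : IsAdmissibleMetric Ω A) (σ τ : VL2 Ω) :
    innerAForm hA σ τ = innerA A σ τ := rfl

theorem innerA_sub_left (hA : IsAdmissibleMetric Ω A) (σ σ' τ : VL2 Ω) :
    innerA A (σ - σ') τ = innerA A σ τ - innerA A σ' τ := by
  simp only [← innerAForm_apply hA, map_sub, LinearMap.sub_apply]

theorem normA_nonneg (σ : VL2 Ω) : 0 ≤ normA A σ := Real.sqrt_nonneg _

theorem normA_sq (hA : IsAdmissibleMetric Ω A) (σ : VL2 Ω) : normA A σ ^ 2 = innerA A σ σ :=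
  Real.sq_sqrt (innerA_nonneg hA σ)

theorem abs_innerA_le (hA : IsAdmissibleMetric Ω A) (σ τ : VL2 Ω) :
    |innerA A σ τ| ≤ normA A σ * normA A τ := by
  refine abs_le_of_sq_le_sq ?_ (mul_nonneg (normA_nonneg σ) (normA_nonneg τ))
  rw [mul_pow, normA_sq hA, normA_sq hA]
  exact (innerAForm hA).apply_sq_le_of_symm (innerA_nonneg hA) ⟨innerA_comm hA⟩ σ τ

theorem normA_add_sq (hA : IsAdmissibleMetric Ω A) (σ τ : VL2 Ω) :
    normA A (σ + τ) ^ 2 = normA A σ ^ 2 + 2 * innerA A σ τ + normA A τ ^ 2 := by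
  rw [normA_sq hA, normA_sq hA, normA_sq hA, innerA_add_left hA, innerA_comm hA σ,
    innerA_comm hA τ, innerA_add_left hA, innerA_add_left hA, innerA_comm hA τ σ]
  ring

theorem normA_add_le (hA : IsAdmissibleMetric Ω A) (σ τ : VL2 Ω) :
    normA A (σ + τ) ≤ normA A σ + normA A τ := by
  refine le_of_sq_le_sq ?_ (add_nonneg (normA_nonneg σ) (normA_nonneg τ))
  rw [normA_add_sq hA]
  nlinarith [(le_abs_self _).trans (abs_innerA_le hA σ τ)]

theorem normA_neg (σ : VL2 Ω) : normA A (-σ) = normA A σ := by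
  have h : innerA A (-σ) (-σ) = innerA A σ σ := by
    refine integral_congr_ae ?_
    filter_upwards [Lp.coeFn_neg σ] with x hx
    rw [hx, Pi.neg_apply, WithLp.ofLp_neg, Matrix.mulVec_neg, neg_dotProduct_neg]
  rw [normA, h, normA]

theorem normA_sub_comm (σ τ : VL2 Ω) : normA A (σ - τ) = normA A (τ - σ) := by
  rw [← normA_neg, neg_sub]

theorem integral_norm_sq_eq (σ : VL2 Ω) : ∫ x in Ω, ‖σ x‖ ^ 2 = ‖σ‖ ^ 2 := by
  rw [← real_inner_self_eq_norm_sq, L2.inner_def]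
  simp only [real_inner_self_eq_norm_sq]

theorem exists_normA_le (hA : IsAdmissibleMetric Ω A) :
    ∃ c : ℝ, 0 ≤ c ∧ ∀ σ : VL2 Ω, normA A σ ≤ c * ‖σ‖ := by
  obtain ⟨c, hc, h⟩ := hA.exists_upper
  refine ⟨Real.sqrt c, Real.sqrt_nonneg _, fun σ => ?_⟩
  refine le_of_sq_le_sq ?_ (by positivity)
  rw [normA_sq hA, mul_pow, Real.sq_sqrt hc, ← integral_norm_sq_eq, ← integral_const_mul]
  refine integral_mono_ae (hA.integrable _ _)
    ((Lp.memLp σ).integrable_norm_pow (by norm_num) |>.const_mul c) ?_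
  filter_upwards [h] with x hx
  refine ((le_abs_self _).trans (hx _ _)).trans (le_of_eq ?_)
  ring

/-- Coercivity of `⟨σ, τ⟩_A`, from the bound on `A⁻¹`. -/
theorem exists_norm_le_normA (hA : IsAdmissibleMetric Ω A) :
    ∃ c : ℝ, 0 < c ∧ ∀ σ : VL2 Ω, ‖σ‖ ≤ c * normA A σ := by
  obtain ⟨c, hc, h⟩ := hA.exists_lower
  refine ⟨Real.sqrt c, Real.sqrt_pos.2 hc, fun σ => ?_⟩
  refine le_of_sq_le_sq ?_ (mul_nonneg (Real.sqrt_nonneg _) (normA_nonneg σ))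
  rw [mul_pow, Real.sq_sqrt hc.le, normA_sq hA, innerA, ← integral_norm_sq_eq,
    ← integral_const_mul]
  refine integral_mono_ae ((Lp.memLp σ).integrable_norm_pow (by norm_num))
    ((hA.integrable _ _).const_mul c) ?_
  filter_upwards [h] with x hx
  exact hx _

/-- `⟨σ, τ⟩_A` as a bounded bilinear form. -/
noncomputable def innerAL (hA : IsAdmissibleMetric Ω A) : VL2 Ω →L[ℝ] VL2 Ω →L[ℝ] ℝ :=
  (innerAForm hA).mkContinuous₂ ((exists_normA_le hA).choose ^ 2) (fun σ τ => by
    obtain ⟨hc, h⟩ := (exists_normA_le hA).choose_spec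
    set c := (exists_normA_le hA).choose
    rw [innerAForm_apply, Real.norm_eq_abs]
    calc |innerA A σ τ| ≤ normA A σ * normA A τ := abs_innerA_le hA σ τ
      _ ≤ (c * ‖σ‖) * (c * ‖τ‖) :=
        mul_le_mul (h σ) (h τ) (normA_nonneg τ) (by positivity)
      _ = c ^ 2 * ‖σ‖ * ‖τ‖ := by ring)

end Metric

/-! ### The Poisson problem -/

section Poisson

variable {n : ℕ} {Ω ΓD : Set (E n)} {A : E n → Matrix (Fin n) (Fin n) ℝ}

/-- Solvability of the Poisson problem. The Lax–Milgram lemma is applied to the coercive form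
`⟨∇u, ∇v⟩_A + ⟨ℋu, ℋv⟩` on all of `H¹(Ω, ΓD)`; testing with `ℋu` shows `ℋu = 0`. -/
theorem exists_solvesPoisson (hΩ : IsBoundedLipschitzDomain Ω) (hA : IsAdmissibleMetric Ω A)
    (F : HNeg1 Ω ΓD) : ∃ u : H1D Ω ΓD, SolvesPoisson A F u := by
  obtain ⟨C, hC, hPF⟩ := exists_norm_sub_locProj_le hΩ ΓD
  obtain ⟨a, ha, hlow⟩ := exists_norm_le_normA hA
  have hin : ∀ v w : H1D Ω ΓD, ‖innerₗ (H1D Ω ΓD) v w‖ ≤ 1 * ‖v‖ * ‖w‖ := fun v w => by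
    rw [one_mul, innerₗ_apply_apply]
    exact norm_inner_le_norm v w
  set B : H1D Ω ΓD →L[ℝ] H1D Ω ΓD →L[ℝ] ℝ :=
    (innerAL hA).bilinearComp (gradL Ω ΓD) (gradL Ω ΓD) +
      ((innerₗ (H1D Ω ΓD)).mkContinuous₂ 1 hin).bilinearComp (locProj Ω ΓD) (locProj Ω ΓD) with hB
  have hBapp : ∀ v w, B v w = innerA A (grad v) (grad w) +
      inner ℝ (locProj Ω ΓD v) (locProj Ω ΓD w) := fun v w => rfl
  have hcoer : IsCoercive B := by
    refine ⟨(2 * (C * a) ^ 2 + 2)⁻¹, by positivity, fun v => ?_⟩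
    rw [hBapp, ← normA_sq hA, real_inner_self_eq_norm_sq, mul_assoc,
      inv_mul_le_iff₀ (by positivity)]
    have h1 : ‖v‖ ≤ ‖v - locProj Ω ΓD v‖ + ‖locProj Ω ΓD v‖ := by
      simpa using norm_add_le (v - locProj Ω ΓD v) (locProj Ω ΓD v)
    have h2 : ‖v - locProj Ω ΓD v‖ ≤ C * a * normA A (grad v) := by
      refine (hPF v).trans ?_
      rw [mul_assoc]
      exact mul_le_mul_of_nonneg_left (hlow _) hC.le
    have h3 : ‖v‖ ≤ C * a * normA A (grad v) + ‖locProj Ω ΓD v‖ := by linarith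
    have h4 := mul_self_le_mul_self (norm_nonneg v) h3
    nlinarith [sq_nonneg (C * a * normA A (grad v) - ‖locProj Ω ΓD v‖),
      mul_nonneg (sq_nonneg (C * a)) (sq_nonneg ‖locProj Ω ΓD v‖), sq_nonneg (normA A (grad v))]
  set u : H1D Ω ΓD := hcoer.continuousLinearEquivOfBilin.symm
    ((InnerProductSpace.toDual ℝ (H1D Ω ΓD)).symm (F - locProjDual F)) with hu
  have hsol : ∀ v, B u v = (F - locProjDual F) v := by
    intro v
    rw [← hcoer.continuousLinearEquivOfBilin_apply, hu, ContinuousLinearEquiv.apply_symm_apply,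
      InnerProductSpace.toDual_symm_apply]
  have hu0 : locProj Ω ΓD u = 0 := by
    have h := hsol (locProj Ω ΓD u)
    rw [hBapp, sub_locProjDual_apply, locProj_locProj, sub_self, map_zero, grad_locProj,
      innerA_comm hA, ← innerAForm_apply hA, map_zero, LinearMap.zero_apply, zero_add] at h
    exact inner_self_eq_zero.1 h
  refine ⟨u, fun v => ?_, (locProj_eq_zero_iff u).1 hu0⟩
  rw [← hsol, hBapp, hu0, inner_zero_left, add_zero]

/-- A field with the same divergence as `∇w` has at least the norm of `∇w`. -/
theorem normA_grad_le (hA : IsAdmissibleMetric Ω A) {τ : VL2 Ω} {w : H1D Ω ΓD}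
    (h : innerA A τ (grad w) = innerA A (grad w) (grad w)) : normA A (grad w) ≤ normA A τ := by
  have h1 := (le_abs_self _).trans (abs_innerA_le hA τ (grad w))
  rw [h, ← normA_sq hA] at h1
  rcases (normA_nonneg (A := A) (grad w)).eq_or_lt with h0 | h0
  · rw [← h0]; exact normA_nonneg τ
  · nlinarith

/-- Both Poincaré–Friedrichs inequalities hold with a common constant. The second one follows from
the first by testing the Poisson problem with its solution. -/
theorem exists_isPFConstant (hΩ : IsBoundedLipschitzDomain Ω) (hA : IsAdmissibleMetric Ω A) :
    ∃ C : ℝ, IsPFConstant Ω ΓD A C := by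
  obtain ⟨C, hC, hPF⟩ := exists_norm_sub_locProj_le hΩ ΓD
  obtain ⟨a, ha, hlow⟩ := exists_norm_le_normA hA
  have hPA : ∀ v : H1D Ω ΓD, ‖v - locProj Ω ΓD v‖ ≤ C * a * normA A (grad v) := by
    intro v
    refine (hPF v).trans ?_
    rw [mul_assoc]
    exact mul_le_mul_of_nonneg_left (hlow _) hC.le
  refine ⟨C * a, by positivity, fun v => (norm_fn_le _).trans (hPA v), fun F => ?_⟩
  obtain ⟨u, hu, hu0⟩ := exists_solvesPoisson hΩ hA F
  refine ⟨grad u, hu, ?_⟩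
  have h1 := (le_abs_self _).trans ((F - locProjDual F).le_opNorm u)
  have h2 := hPA u
  rw [(locProj_eq_zero_iff u).2 hu0, sub_zero] at h2
  rw [← hu u, ← normA_sq hA] at h1
  rcases (normA_nonneg (A := A) (grad u)).eq_or_lt with h0 | h0
  · rw [← h0]; positivity
  · have h3 := mul_le_mul_of_nonneg_left h2 (norm_nonneg (F - locProjDual F))
    nlinarith

theorem eq_of_solvesPoisson (hΩ : IsBoundedLipschitzDomain Ω) (hA : IsAdmissibleMetric Ω A)
    {F : HNeg1 Ω ΓD} {u w : H1D Ω ΓD} (hu : SolvesPoisson A F u) (hw : SolvesPoisson A F w) :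
    u = w := by
  obtain ⟨C, hC, hPF⟩ := exists_norm_sub_locProj_le hΩ ΓD
  obtain ⟨a, ha, hlow⟩ := exists_norm_le_normA hA
  have h1 : innerA A (grad (u - w)) (grad (u - w)) = 0 := by
    conv_lhs => rw [grad_sub u w, innerA_sub_left hA, ← grad_sub]
    rw [hu.1, hw.1, sub_self]
  have h2 : normA A (grad (u - w)) = 0 := by rw [normA, h1, Real.sqrt_zero]
  have h3 : grad (u - w) = 0 := norm_le_zero_iff.1 (by simpa [h2] using hlow (grad (u - w)))
  have h4 : locProj Ω ΓD (u - w) = 0 := by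
    rw [map_sub, (locProj_eq_zero_iff u).2 hu.2, (locProj_eq_zero_iff w).2 hw.2, sub_zero]
  have h5 := hPF (u - w)
  rw [h4, sub_zero, h3, norm_zero, mul_zero] at h5
  exact sub_eq_zero.1 (norm_le_zero_iff.1 h5)

/-- Perturbing the data by `F - Fh` perturbs the gradient of the solution by at most the
Poincaré–Friedrichs constant times the perturbation. -/
theorem normA_grad_sub_le (hA : IsAdmissibleMetric Ω A) {C : ℝ} (hC : IsPFConstant Ω ΓD A C)
    {F Fh : HNeg1 Ω ΓD} {u w : H1D Ω ΓD} (hu : SolvesFlux A F (grad u))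
    (hw : SolvesFlux A Fh (grad w)) : normA A (grad (u - w)) ≤ C * ‖F - Fh‖ := by
  obtain ⟨τ, hτ, hle⟩ := hC.div_ineq (F - Fh)
  refine (normA_grad_le hA ?_).trans (hle.trans
    (mul_le_mul_of_nonneg_left (norm_sub_locProjDual_le _) hC.pos.le))
  rw [hτ]
  conv_rhs => rw [grad_sub u w, innerA_sub_left hA, ← grad_sub]
  rw [hu, hw, sub_locProjDual_apply, sub_locProjDual_apply, sub_locProjDual_apply]
  rfl

end Poisson

end PoissonFlux

open PoissonFlux
theorem mainTheorem2 {n : ℕ} {Ω ΓD ΓN : Set (EuclideanSpace ℝ (Fin n))}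
    (hΩ : IsBoundedLipschitzDomain Ω) (hΓ : IsBoundaryPartition Ω ΓD ΓN)
    {A : EuclideanSpace ℝ (Fin n) → Matrix (Fin n) (Fin n) ℝ} (hA : IsAdmissibleMetric Ω A) :
    (∃ C : ℝ, IsPFConstant Ω ΓD A C) ∧
    ∀ C : ℝ, IsPFConstant Ω ΓD A C →
    ∀ (F Fh : HNeg1 Ω ΓD) (u uh : H1D Ω ΓD) (σh : VL2 Ω),
      SolvesPoisson A F u → SolvesFlux A Fh σh →
      -- reliability
      normA A (grad u - grad uh) ≤ C * ‖F - Fh‖ + normA A (σh - grad uh) ∧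
      -- the approximate Poisson problem and the Hodge decomposition `σh = ∇û + θ`
      ∃ (uhat : H1D Ω ΓD) (θ : VL2 Ω),
        SolvesPoisson A Fh uhat ∧ (∀ w : H1D Ω ΓD, SolvesPoisson A Fh w → w = uhat) ∧
        θ ∈ divFree Ω ΓD A ∧ σh = grad uhat + θ ∧
        (∀ w : H1D Ω ΓD, ∀ θ' ∈ divFree Ω ΓD A, σh = grad w + θ' → θ' = θ) ∧
        -- efficiency
        (normA A (grad u - grad uh) ≠ 0 →
          1 ≤ C * (‖F - Fh‖ / normA A (grad u - grad uh))
              + normA A (σh - grad uh) / normA A (grad u - grad uh) ∧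
          C * (‖F - Fh‖ / normA A (grad u - grad uh))
              + normA A (σh - grad uh) / normA A (grad u - grad uh)
            ≤ 1 + 2 * C * (‖F - Fh‖ / normA A (grad u - grad uh))
              + normA A θ / normA A (grad u - grad uh)) ∧
        -- exact data: the hypercircle identity of Prager and Synge
        (Fh = F → uhat = u ∧
          normA A (grad uh - σh) ^ 2
            = normA A (grad uh - grad u) ^ 2 + normA A (grad u - σh) ^ 2 ∧
          (normA A (grad uh - grad u) ≠ 0 →
            normA A (grad uh - σh) ^ 2 / normA A (grad uh - grad u) ^ 2
              = 1 + normA A θ ^ 2 / normA A (grad uh - grad u) ^ 2)) := by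
  refine ⟨exists_isPFConstant hΩ hA, fun C hC F Fh u uh σh hu hσ => ?_⟩
  obtain ⟨w, hw⟩ := exists_solvesPoisson hΩ hA Fh
  have hθ : σh - grad w ∈ divFree Ω ΓD A := fun v => by
    rw [innerA_sub_left hA, hσ, hw.1, sub_self]
  have hθ0 : ∀ v : H1D Ω ΓD, innerA A (σh - grad w) (grad v) = 0 := hθ
  have hdata : normA A (grad (u - w)) ≤ C * ‖F - Fh‖ := normA_grad_sub_le hA hC hu.1 hw.1
  have hdisc : normA A (grad (w - uh)) ≤ normA A (σh - grad uh) := by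
    refine normA_grad_le hA ?_
    have e : σh - grad uh = (σh - grad w) + grad (w - uh) := by rw [grad_sub]; abel
    rw [e, innerA_add_left hA, hθ0, zero_add]
  have hrel : normA A (grad u - grad uh) ≤ C * ‖F - Fh‖ + normA A (σh - grad uh) := by
    have e : grad u - grad uh = grad (u - w) + grad (w - uh) := by
      rw [grad_sub, grad_sub]; abel
    rw [e]
    exact (normA_add_le hA _ _).trans (add_le_add hdata hdisc)
  refine ⟨hrel, w, σh - grad w, hw, fun v hv => eq_of_solvesPoisson hΩ hA hv hw, hθ, by abel,
    fun v θ' hθ' hv => ?_, fun he => ?_, fun hF => ?_⟩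
  · -- the difference of two decompositions is a divergence-free gradient
    have e : σh - grad w - θ' = grad (v - w) := by rw [hv, grad_sub]; abel
    have h0 : innerA A (σh - grad w - θ') (σh - grad w - θ') = 0 := by
      conv_lhs => rw [innerA_sub_left hA, e, hθ0, show innerA A θ' (grad (v - w)) = 0 from hθ' _]
      exact sub_self 0
    obtain ⟨a, -, hlow⟩ := exists_norm_le_normA hA
    have h1 := hlow (σh - grad w - θ')
    rw [normA, h0, Real.sqrt_zero, mul_zero] at h1
    exact (sub_eq_zero.1 (norm_le_zero_iff.1 h1)).symm
  · have hpos : 0 < normA A (grad u - grad uh) := lt_of_le_of_ne (normA_nonneg _) he.symm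
    have heff : normA A (σh - grad uh) ≤
        normA A (σh - grad w) + (C * ‖F - Fh‖ + normA A (grad u - grad uh)) := by
      have e : σh - grad uh = (σh - grad w) + (-grad (u - w) + (grad u - grad uh)) := by
        rw [grad_sub]; abel
      rw [e]
      refine (normA_add_le hA _ _).trans (add_le_add le_rfl
        ((normA_add_le hA _ _).trans (add_le_add ?_ le_rfl)))
      rwa [normA_neg]
    constructor
    · rw [← mul_div_assoc, ← add_div, le_div_iff₀ hpos, one_mul]
      exact hrel
    · rw [← mul_div_assoc, ← mul_div_assoc, ← add_div, add_assoc, ← add_div, div_le_iff₀ hpos,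
        add_mul, div_mul_cancel₀ _ he]
      linarith
  · subst hF
    obtain rfl := eq_of_solvesPoisson hΩ hA hu hw
    have hpyth : normA A (grad uh - σh) ^ 2
        = normA A (grad uh - grad u) ^ 2 + normA A (grad u - σh) ^ 2 := by
      have e : σh - grad uh = (σh - grad u) + grad (u - uh) := by rw [grad_sub]; abel
      rw [normA_sub_comm _ σh, e, normA_add_sq hA, hθ0, grad_sub, normA_sub_comm (grad u),
        normA_sub_comm σh]
      ring
    refine ⟨rfl, hpyth, fun he => ?_⟩
    rw [hpyth, add_div, div_self (pow_ne_zero 2 he), normA_sub_comm (grad u) σh]
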